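/- For an integer $m\ge 4$ let $\mathbb S^m\subset\mathbb R^{m+1}$ be the unit sphere with its round metric $g$ and volume measure $v_g$, and let $\omega_{\mathbb S^m}$ be its volume. For a smooth map $\phi:(M,g)\to(N,h)$ between Riemannian manifolds with $M$ compact, let $\tau(\phi)=\operatorname{Tr}\nabla d\phi$ be its tension field and let $$E_2^c(\phi)=\frac12\int_M\Big(|\tau(\phi)|^2+\tfrac23\operatorname{Scal}\,|d\phi|^2-2\operatorname{Tr}\langle d\phi(\operatorname{Ric}(\cdot)),d\phi(\cdot)\rangle\Big)\,v_g$$ be its conformal bienergy, where $\operatorname{Ric}$ and $\operatorname{Scal}$ are the Ricci tensor and the scalar curvature of $(M,g)$. Write points of $\mathbb S^m$ other than the two poles $(0,\pm1)$ as $(\sin r\cdot\theta,\cos r)$ with $\theta\in\mathbb S^{m-1}$ and $r\in(0,\pi)$. For $t>0$ let $\phi_t:\mathbb S^m\to\mathbb S^m$ be the map that fixes both poles and is given elsewhere by $$\phi_t(\theta,r)=(\theta,\alpha_t(r)),\qquad \alpha_t(r)=2\arctan\big(t\tan\tfrac r2\big).$$ Then $\phi_t$ is smooth and $h_m^c(t):=E_2^c(\phi_t)$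 is positive for every $t>0$, so that $h_m^c$ is a function $(0,\infty)\to(0,\infty)$, and: 1. if $m=4$, the function $h_4^c$ is constant: $h_4^c(t)=4\,\omega_{\mathbb S^4}$ for all $t>0$; 2. if $m\ge5$, the point $t=1$ is a local maximum of $h_m^c$, and $\lim_{t\to0^+}h_m^c(t)=0$. -/

import Mathlib

open MeasureTheory Filter Topology Bundle
open scoped Manifold ContDiff

noncomputable section

namespace ConformalBienergy

/-- Standard Euclidean space `ℝⁿ`. -/
abbrev Euc (n : ℕ) : Type := EuclideanSpace ℝ (Fin n)

/-- The `i`-th standard basis vector of `ℝⁿ`. -/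
def basisVec {n : ℕ} (i : Fin n) : Euc n := EuclideanSpace.single i 1

/-- The `i`-th partial derivative of `f : ℝⁿ → ℝ` at `y`. -/
def partialD {n : ℕ} (i : Fin n) (f : Euc n → ℝ) (y : Euc n) : ℝ :=
  fderiv ℝ f y (basisVec i)

/-! ### Local Riemannian geometry of a matrix of metric coefficients -/

/-- Christoffel symbols `Γ^k_{ij} = ½ g^{kl} (∂_i g_{jl} + ∂_j g_{il} - ∂_l g_{ij})`. -/
def christoffel {n : ℕ} (G : Euc n → Matrix (Fin n) (Fin n) ℝ) (k i j : Fin n) (y : Euc n) : ℝ :=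
  (1 / 2) * ∑ l, (G y)⁻¹ k l *
    (partialD i (fun z => G z j l) y + partialD j (fun z => G z i l) y
      - partialD l (fun z => G z i j) y)

/-- The component `R^l` of the curvature `R(∂_i, ∂_j) ∂_k = R^l_{ijk} ∂_l`, where
`R(X, Y) Z = [∇_X, ∇_Y] Z - ∇_{[X, Y]} Z`. -/
def curvature {n : ℕ} (G : Euc n → Matrix (Fin n) (Fin n) ℝ) (l i j k : Fin n) (y : Euc n) : ℝ :=
  partialD i (christoffel G l j k) y - partialD j (christoffel G l i k) y
    + ∑ p, (christoffel G l i p y * christoffel G p j k y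
      - christoffel G l j p y * christoffel G p i k y)

/-- Ricci tensor `Ric(∂_j, ∂_k) = Tr (Z ↦ R(Z, ∂_j) ∂_k)`. -/
def ricci {n : ℕ} (G : Euc n → Matrix (Fin n) (Fin n) ℝ) (j k : Fin n) (y : Euc n) : ℝ :=
  ∑ i, curvature G i i j k y

/-! ### Riemannian manifolds and maps between them

`M` and `N` are manifolds without boundary of dimensions `m` and `n`. Every quantity at a point
`x` is computed in the preferred charts at `x` and at `φ x`. Recall that `TangentSpace (𝓡 m) x`
is, in Mathlib, the model space `ℝᵐ`, through the preferred chart at `x`. -/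

/-- Smooth Riemannian metrics on a smooth `m`-manifold. -/
abbrev RiemMetric (m : ℕ) (M : Type*) [TopologicalSpace M] [ChartedSpace (Euc m) M]
    [IsManifold (𝓡 m) ∞ M] : Type _ :=
  ContMDiffRiemannianMetric (𝓡 m) ∞ (Euc m) (fun x : M => TangentSpace (𝓡 m) x)

section Manifold

variable {m n : ℕ}
  {M : Type*} [TopologicalSpace M] [ChartedSpace (Euc m) M] [IsManifold (𝓡 m) ∞ M]
  {N : Type*} [TopologicalSpace N] [ChartedSpace (Euc n) N] [IsManifold (𝓡 n) ∞ N]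

/-- The metric coefficients `g_{ij} = g(∂_i, ∂_j)` in the preferred chart at `x`, as a function
of the coordinates. -/
def metricCoeff (g : RiemMetric m M) (x : M) (y : Euc m) : Matrix (Fin m) (Fin m) ℝ :=
  Matrix.of fun i j =>
    g.inner ((extChartAt (𝓡 m) x).symm y)
      (mfderiv 𝓘(ℝ, Euc m) (𝓡 m) (extChartAt (𝓡 m) x).symm y (basisVec i))
      (mfderiv 𝓘(ℝ, Euc m) (𝓡 m) (extChartAt (𝓡 m) x).symm y (basisVec j))

/-- The inverse metric coefficients `g^{ij}` at the point `x`. -/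
def invMetric (g : RiemMetric m M) (x : M) : Matrix (Fin m) (Fin m) ℝ :=
  (metricCoeff g x (extChartAt (𝓡 m) x x))⁻¹

/-- The Ricci tensor `Ric_{ij}` at the point `x`. -/
def ricciAt (g : RiemMetric m M) (x : M) (i j : Fin m) : ℝ :=
  ricci (metricCoeff g x) i j (extChartAt (𝓡 m) x x)

/-- The scalar curvature `Scal = Tr Ric = g^{ij} Ric_{ij}`. -/
def scal (g : RiemMetric m M) (x : M) : ℝ :=
  ∑ i, ∑ j, invMetric g x i j * ricciAt g x i j

/-- The coefficients `(φ^*h)_{ij} = ⟨dφ(∂_i), dφ(∂_j)⟩` at `x`. -/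
def pullbackCoeff (h : RiemMetric n N) (φ : M → N) (x : M) (i j : Fin m) : ℝ :=
  h.inner (φ x) (mfderiv (𝓡 m) (𝓡 n) φ x (basisVec i : Euc m))
    (mfderiv (𝓡 m) (𝓡 n) φ x (basisVec j : Euc m))

/-- `|dφ|² = g^{ij} ⟨dφ(∂_i), dφ(∂_j)⟩`. -/
def normSqDifferential (g : RiemMetric m M) (h : RiemMetric n N) (φ : M → N) (x : M) : ℝ :=
  ∑ i, ∑ j, invMetric g x i j * pullbackCoeff h φ x i j

/-- `Tr ⟨dφ(Ric(·)), dφ(·)⟩ = g^{ij} ⟨dφ(Ric(∂_i)), dφ(∂_j)⟩`, with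
`Ric(∂_i) = g^{kl} Ric_{il} ∂_k`. -/
def traceRicci (g : RiemMetric m M) (h : RiemMetric n N) (φ : M → N) (x : M) : ℝ :=
  ∑ i, ∑ j, ∑ k, ∑ l,
    invMetric g x i j * (invMetric g x k l * ricciAt g x i l) * pullbackCoeff h φ x k j

/-- The `a`-th component of `φ` in the preferred charts at `x` and `φ x`. -/
def localMap (φ : M → N) (x : M) (a : Fin n) (y : Euc m) : ℝ :=
  (writtenInExtChartAt (𝓡 m) (𝓡 n) x φ y : Euc n) a

/-- The tension field `τ(φ) = Tr ∇dφ`, with components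
`τ^a = g^{ij} (∂_i∂_j φ^a - Γ^k_{ij} ∂_k φ^a + Γ'^a_{bc} ∂_i φ^b ∂_j φ^c)`. -/
def tension (g : RiemMetric m M) (h : RiemMetric n N) (φ : M → N) (x : M) : TangentSpace (𝓡 n) (φ x) :=
  (WithLp.toLp 2 fun a : Fin n => ∑ i, ∑ j, invMetric g x i j *
    (partialD i (partialD j (localMap φ x a)) (extChartAt (𝓡 m) x x)
      - ∑ k, christoffel (metricCoeff g x) k i j (extChartAt (𝓡 m) x x) *
          partialD k (localMap φ x a) (extChartAt (𝓡 m) x x)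
      + ∑ b, ∑ c, christoffel (metricCoeff h (φ x)) a b c (extChartAt (𝓡 n) (φ x) (φ x)) *
          partialD i (localMap φ x b) (extChartAt (𝓡 m) x x) *
          partialD j (localMap φ x c) (extChartAt (𝓡 m) x x)) : Euc n)

/-- The conformal bienergy
`E₂ᶜ(φ) = ½ ∫_M (|τ(φ)|² + ⅔ Scal |dφ|² - 2 Tr ⟨dφ(Ric(·)), dφ(·)⟩) v_g`
of a smooth map `φ : (M, g) → (N, h)`, where `vol` is the Riemannian measure `v_g`. -/
def conformalBienergy [MeasurableSpace M] (g : RiemMetric m M) (h : RiemMetric n N) (vol : Measure M)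
    (φ : M → N) : ℝ :=
  (1 / 2) * ∫ x, (h.inner (φ x) (tension g h φ x) (tension g h φ x)
    + (2 / 3) * scal g x * normSqDifferential g h φ x - 2 * traceRicci g h φ x) ∂vol

end Manifold

/-! ### The round sphere -/

/-- The unit sphere `𝕊ᵐ` in `ℝᵐ⁺¹`. -/
abbrev Sphere (m : ℕ) : Type := Metric.sphere (0 : Euc (m + 1)) 1

/-- The differential of the inclusion `𝕊ᵐ → ℝᵐ⁺¹` at `x`. -/
def dIncl (m : ℕ) (x : Sphere m) : TangentSpace (𝓡 m) x →L[ℝ] Euc (m + 1) :=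
  mvfderiv (𝓡 m) (fun y : Sphere m => (y : Euc (m + 1))) x

/-- The metric induced on `T_x 𝕊ᵐ` by the inclusion `𝕊ᵐ → ℝᵐ⁺¹`. -/
def roundInner (m : ℕ) (x : Sphere m) :
    TangentSpace (𝓡 m) x →L[ℝ] TangentSpace (𝓡 m) x →L[ℝ] ℝ :=
  ((innerSL ℝ (E := Euc (m + 1))).bilinearComp (E' := Euc m) (F' := Euc m)
    (dIncl m x) (dIncl m x) : Euc m →L[ℝ] Euc m →L[ℝ] ℝ)

theorem roundInner_apply (m : ℕ) (x : Sphere m) (u v : TangentSpace (𝓡 m) x) :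
    roundInner m x u v = inner ℝ (dIncl m x u) (dIncl m x v) := rfl

theorem dIncl_injective (m : ℕ) (x : Sphere m) : Function.Injective (dIncl m x) :=
  haveI : Fact (Module.finrank ℝ (Euc (m + 1)) = m + 1) := ⟨by simp⟩
  injective_mvfderiv_subtypeVal_sphere x

theorem roundInner_isVonNBounded (m : ℕ) (x : Sphere m) :
    Bornology.IsVonNBounded ℝ {v : TangentSpace (𝓡 m) x | roundInner m x v v < 1} := by
  obtain ⟨K, hK, hl⟩ :=
    (LinearMap.injective_iff_antilipschitz (𝕜 := ℝ) (E := Euc m) (F := Euc (m + 1))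
      (dIncl m x).toLinearMap).1 (dIncl_injective m x)
  change Bornology.IsVonNBounded ℝ {v : Euc m | roundInner m x v v < 1}
  refine (NormedSpace.isVonNBounded_ball ℝ (Euc m) (K + 1)).subset ?_
  intro v hv
  have h1 : ‖(dIncl m x v : Euc (m + 1))‖ < 1 := by
    have h2 : ‖(dIncl m x v : Euc (m + 1))‖ ^ 2 < 1 := by
      rw [← real_inner_self_eq_norm_sq]; exact hv
    nlinarith [norm_nonneg (dIncl m x v : Euc (m + 1))]
  have h3 := hl.le_mul_dist v 0
  have h4 : dist (dIncl m x v) (dIncl m x (0 : Euc m)) = ‖(dIncl m x v : Euc (m + 1))‖ := by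
    rw [show dIncl m x (0 : Euc m) = 0 from map_zero (dIncl m x), dist_zero_right]
  replace h3 : dist v 0 ≤ K * ‖(dIncl m x v : Euc (m + 1))‖ := h4 ▸ h3
  rw [Metric.mem_ball]
  have hK' : (0 : ℝ) < K := by exact_mod_cast hK
  nlinarith

theorem contDiff_pullbackForm {F W : Type*} [NormedAddCommGroup F] [NormedSpace ℝ F]
    [FiniteDimensional ℝ F] [NormedAddCommGroup W] [NormedSpace ℝ W] (B : W →L[ℝ] W →L[ℝ] ℝ) :
    ContDiff ℝ ∞ (fun A : F →L[ℝ] W => B.bilinearComp A A) := by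
  refine contDiff_clm_apply_iff.2 fun u => contDiff_clm_apply_iff.2 fun v => ?_
  change ContDiff ℝ ∞ (fun A : F →L[ℝ] W => B (A u) (A v))
  have h1 : ∀ w : F, ContDiff ℝ ∞ (fun A : F →L[ℝ] W => A w) := fun w =>
    contDiff_id.clm_apply contDiff_const
  exact (B.contDiff.comp (h1 u)).clm_apply (h1 v)

theorem roundInner_contMDiff (m : ℕ) :
    ContMDiff (𝓡 m) ((𝓡 m).prod 𝓘(ℝ, Euc m →L[ℝ] Euc m →L[ℝ] ℝ)) ∞
      (fun x : Sphere m => TotalSpace.mk' (Euc m →L[ℝ] Euc m →L[ℝ] ℝ)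
        (E := fun x : Sphere m => TangentSpace (𝓡 m) x →L[ℝ] TangentSpace (𝓡 m) x →L[ℝ] ℝ)
        x (roundInner m x)) := by
  intro x
  have : Fact (Module.finrank ℝ (Euc (m + 1)) = m + 1) := ⟨by simp⟩
  rw [contMDiffAt_section]
  have hD := ((contMDiff_coe_sphere (E := Euc (m + 1)) (n := m) (m := ∞)) x).mfderiv_const
    (m := ∞) (by simp)
  have hB := (contDiff_pullbackForm (F := Euc m) (innerSL ℝ (E := Euc (m + 1)))).contMDiff.contMDiffAt.comp x hD
  have hs : (trivializationAt (Euc m) (TangentSpace (𝓡 m)) x).baseSet ∈ 𝓝 x :=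
    (trivializationAt (Euc m) (TangentSpace (𝓡 m)) x).open_baseSet.mem_nhds
      (mem_baseSet_trivializationAt _ _ x)
  refine hB.congr_of_eventuallyEq (Filter.mem_of_superset hs fun y hy => ?_)
  ext u v
  have key := inCoordinates_apply_eq₂ (𝕜 := ℝ) (F₁ := Euc m) (F₂ := Euc m)
    (F₃ := ℝ) (E₁ := fun y : Sphere m => TangentSpace (𝓡 m) y)
    (E₂ := fun y : Sphere m => TangentSpace (𝓡 m) y) (E₃ := fun _ : Sphere m => ℝ)
    (x₀ := x) (x := y) (ϕ := roundInner m y) (v := u) (w := v) hy hy (by simp)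
  have hA : ∀ w : Euc m,
      inTangentCoordinates (𝓡 m) 𝓘(ℝ, Euc (m + 1)) id (fun z : Sphere m => (z : Euc (m + 1)))
        (mfderiv (𝓡 m) 𝓘(ℝ, Euc (m + 1)) (fun z : Sphere m => (z : Euc (m + 1)))) x y w
      = dIncl m y ((trivializationAt (Euc m) (TangentSpace (𝓡 m)) x).symm y w) := by
    intro w
    rw [← Trivialization.symmL_apply (R := ℝ) _ hy]
    simp only [inTangentCoordinates, ContinuousLinearMap.inCoordinates,
      TangentBundle.continuousLinearMapAt_model_space]
    rfl
  refine key.trans ?_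
  simp only [Function.comp_apply, ContinuousLinearMap.bilinearComp_apply]
  rw [hA, hA]
  simp
  rfl

/-- The round metric of `𝕊ᵐ`. -/
def roundMetric (m : ℕ) : RiemMetric m (Sphere m) where
  inner := roundInner m
  symm x v w := by rw [roundInner_apply, roundInner_apply, real_inner_comm]
  pos x v hv := by
    rw [roundInner_apply]
    refine real_inner_self_pos.2 fun h => hv (dIncl_injective m x ?_)
    rw [h, map_zero]
  isVonNBounded := roundInner_isVonNBounded m
  contMDiff := roundInner_contMDiff m

/-- The Riemannian measure of the round sphere, i.e. its surface measure. -/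
def sphereVolume (m : ℕ) : Measure (Sphere m) := (volume : Measure (Euc (m + 1))).toSphere

/-! ### The maps `φ_t`

In polar coordinates `(θ, r) ∈ 𝕊ᵐ⁻¹ × (0, π)`, `φ_t` is `(θ, r) ↦ (θ, α_t(r))`. -/

/-- The point `(sin r · θ, cos r)` of `ℝᵐ⁺¹`, with polar coordinates `(θ, r)`. -/
def polar {m : ℕ} (θ : Euc m) (r : ℝ) : Euc (m + 1) :=
  WithLp.toLp 2 (Fin.snoc (α := fun _ => ℝ) (fun i => Real.sin r * θ i) (Real.cos r))

/-- The first `m` coordinates of a point of `ℝᵐ⁺¹`. -/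
def horizontal {m : ℕ} (x : Euc (m + 1)) : Euc m := WithLp.toLp 2 fun i => x i.castSucc

/-- The polar coordinate `r` of a point of `𝕊ᵐ`. -/
def colatitude {m : ℕ} (x : Euc (m + 1)) : ℝ := Real.arccos (x (Fin.last m))

/-- The polar coordinate `θ` of a point of `𝕊ᵐ` other than the poles. -/
def longitude {m : ℕ} (x : Euc (m + 1)) : Euc m := ‖horizontal x‖⁻¹ • horizontal x

/-- `α_t(r) = 2 arctan (t tan (r / 2))`. -/
def alpha (t r : ℝ) : ℝ := 2 * Real.arctan (t * Real.tan (r / 2))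

open Classical in
/-- `φ_t` as a map into `ℝᵐ⁺¹`; it fixes the two poles. -/
def phiVec {m : ℕ} (t : ℝ) (x : Euc (m + 1)) : Euc (m + 1) :=
  if horizontal x = 0 then x else polar (longitude x) (alpha t (colatitude x))

theorem norm_polar {m : ℕ} {θ : Euc m} (hθ : ‖θ‖ = 1) (r : ℝ) : ‖polar θ r‖ = 1 := by
  have h1 : ∑ i, θ i ^ 2 = 1 := by
    rw [← EuclideanSpace.real_norm_sq_eq, hθ, one_pow]
  have h2 : ‖polar θ r‖ ^ 2 = 1 := by
    rw [EuclideanSpace.real_norm_sq_eq, Fin.sum_univ_castSucc]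
    simp only [polar, Fin.snoc_castSucc, Fin.snoc_last, mul_pow]
    rw [← Finset.mul_sum, h1, mul_one, Real.sin_sq_add_cos_sq]
  nlinarith [norm_nonneg (polar θ r)]

theorem phiVec_mem {m : ℕ} (t : ℝ) (x : Sphere m) :
    phiVec t (x : Euc (m + 1)) ∈ Metric.sphere (0 : Euc (m + 1)) 1 := by
  unfold phiVec
  split_ifs with h
  · exact x.2
  · rw [mem_sphere_zero_iff_norm]
    refine norm_polar ?_ _
    rw [longitude, norm_smul, norm_inv, norm_norm, inv_mul_cancel₀ (norm_ne_zero_iff.2 h)]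

/-- The map `φ_t : 𝕊ᵐ → 𝕊ᵐ`. -/
def phi (m : ℕ) (t : ℝ) (x : Sphere m) : Sphere m := ⟨phiVec t x, phiVec_mem t x⟩

/-- `h_m^c(t) = E₂ᶜ(φ_t)`. -/
def hc (m : ℕ) (t : ℝ) : ℝ :=
  conformalBienergy (roundMetric m) (roundMetric m) (sphereVolume m) (phi m t)

end ConformalBienergy

end

noncomputable section

namespace ConformalBienergy

/-! Put u = (1 - t²)/(1 + t²) and w = 2t/(1 + t²), so w² = 1 - u². The half-angle formulas turn
`φ_t` into the projective map x ↦ (w x' , s + u)/(1 + u s), where x = (x', s) and s is the height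
(`coe_phi`). The denominator never vanishes on the sphere, which gives smoothness at the poles too.
The map is conformal with factor w²/(1 + u s)² (`pullbackCoeff_phi`). In the stereographic charts
centred at x and `φ_t(x)` all Christoffel symbols vanish at the origin, so the tension field is a
flat Laplacian there; the local map is a quotient of quadratic polynomials, and the Laplacian is
explicit (`sum_partialD_localMap_phi`).

With Ric = (m - 1)g this gives an integrand that depends on s alone (`integrand_phi`, `density`): (1
- u²)(a u²(1 - s²)/(1 + u s)⁴ + B/(1 + u s)²), with a = (m - 2)² and B = (2/3) m (m - 1)(m - 3). It
is positive for m ≥ 4. What remains is one-variable analysis driven by the divergence identity ∫ ((1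
- s²) k'(s) - m s k(s)) = 0 (`integral_divergence_height`), itself a consequence of the invariance
of the surface measure under linear isometries.

For m = 4 the density differs from 8 by such a divergence. For m ≥ 5, expanding at u = 0 (that is, t
= 1) gives a u² coefficient which is a negative multiple of (m - 2) m (2m - 3)(m - 4), hence a local
maximum. As t → 0, u → 1 and the density concentrates at the south pole; it is at most a constant
times √w (1 + u s)^(-9/4), and the integral of that power stays bounded because 2 · 9/4 < 5 ≤ m
(`integral_rpow_le`), while w → 0. -/

/-! ### The preferred chart as a stereographic projection. -/

theorem fact_finrank_euc (m : ℕ) : Fact (Module.finrank ℝ (Euc (m + 1)) = m + 1) := ⟨by simp⟩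

/-- The coordinates on the orthogonal complement used by the preferred chart at `x`. -/
def complementRepr {m : ℕ} (x : Sphere m) :
    (Submodule.span ℝ {((-x : Sphere m) : Euc (m + 1))})ᗮ ≃ₗᵢ[ℝ] Euc m :=
  haveI := fact_finrank_euc m
  (OrthonormalBasis.fromOrthogonalSpanSingleton (𝕜 := ℝ) m (ne_zero_of_mem_unit_sphere (-x))).repr

/-- The isometric embedding of `ℝᵐ` onto `x^⊥` underlying the preferred chart at `x`. -/
def frame {m : ℕ} (x : Sphere m) : Euc m →ₗᵢ[ℝ] Euc (m + 1) :=
  (Submodule.subtypeₗᵢ _).comp (complementRepr x).symm.toLinearIsometry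

theorem frame_apply {m : ℕ} (x : Sphere m) (y : Euc m) :
    frame x y = ((complementRepr x).symm y : Euc (m + 1)) := rfl

theorem inner_frame_self {m : ℕ} (x : Sphere m) (y : Euc m) :
    inner ℝ (frame x y) (x : Euc (m + 1)) = 0 := by
  have h := ((complementRepr x).symm y).2
  rw [Submodule.mem_orthogonal_singleton_iff_inner_left] at h
  simpa [frame_apply] using h

/-- The preferred chart at x is the stereographic projection from the antipode -x, so x itself sits
at the origin of its chart. -/
theorem coe_extChartAt_symm {m : ℕ} (x : Sphere m) (y : Euc m) :
    (((extChartAt (𝓡 m) x).symm y : Sphere m) : Euc (m + 1)) =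
      (‖y‖ ^ 2 + 4)⁻¹ • ((4 : ℝ) • frame x y + (8 : ℝ) • (x : Euc (m + 1))) - x := by
  have := fact_finrank_euc m
  have h := stereographic'_symm_apply (-x) y
  have h2 : ‖y‖ ^ 2 + 4 ≠ 0 := by positivity
  have h3 : ‖((complementRepr x).symm y : Euc (m + 1))‖ = ‖y‖ := by
    rw [Submodule.norm_coe, LinearIsometryEquiv.norm_map]
  change _ = (‖((complementRepr x).symm y : Euc (m + 1))‖ ^ 2 + 4)⁻¹ • (4 : ℝ) • frame x y +
    (‖((complementRepr x).symm y : Euc (m + 1))‖ ^ 2 + 4)⁻¹ •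
      (‖((complementRepr x).symm y : Euc (m + 1))‖ ^ 2 - 4) • (-(x : Euc (m + 1))) at h
  rw [h3] at h
  refine Eq.trans (?_ : _ = (((stereographic' m (-x)).symm y : Sphere m) : Euc (m+1))) (h.trans ?_)
  · simp only [mfld_simps]; rfl
  · match_scalars <;> field_simp
    ring

theorem complementRepr_apply {m : ℕ} (x : Sphere m)
    (w : (Submodule.span ℝ {((-x : Sphere m) : Euc (m + 1))})ᗮ) (i : Fin m) :
    (complementRepr x w : Euc m) i = inner ℝ (frame x (basisVec i)) (w : Euc (m + 1)) := by
  rw [frame_apply, ← Submodule.coe_inner, ← (complementRepr x).inner_map_map,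
    LinearIsometryEquiv.apply_symm_apply]
  simp [basisVec, PiLp.inner_apply]

/-- The projection onto x^⊥ built into the stereographic map disappears on pairing with a frame
vector, which already lies in x^⊥. -/
theorem extChartAt_apply {m : ℕ} (x z : Sphere m) (a : Fin m) :
    (extChartAt (𝓡 m) x z : Euc m) a =
      2 / (1 + inner ℝ (x : Euc (m + 1)) z) * inner ℝ (frame x (basisVec a)) (z : Euc (m + 1)) := by
  have := fact_finrank_euc m
  have h : (extChartAt (𝓡 m) x z : Euc m) = stereographic' m (-x) z := by
    simp only [mfld_simps]; rfl
  have h1 : stereographic' m (-x) z = complementRepr x (stereoToFun ((-x : Sphere m) : Euc (m + 1)) z) := rfl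
  rw [h, h1, complementRepr_apply, stereoToFun_apply, Submodule.coe_smul, inner_smul_right]
  have h4 : (-x : Sphere m).val = -(x : Euc (m+1)) := rfl
  congr 1
  · simp [h4]
  · rw [← Submodule.starProjection_apply, ← Submodule.inner_starProjection_left_eq_right]
    rw [frame_apply, Submodule.starProjection_eq_self_iff.2 (Submodule.coe_mem _)]

theorem extChartAt_self {m : ℕ} (x : Sphere m) : (extChartAt (𝓡 m) x x : Euc m) = 0 := by
  ext a
  rw [extChartAt_apply, inner_frame_self]; simp

theorem extChartAt_target {m : ℕ} (x : Sphere m) : (extChartAt (𝓡 m) x).target = Set.univ := by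
  have := fact_finrank_euc m
  simp only [mfld_simps]
  exact stereographic'_target _

/-! ### The round metric in stereographic coordinates -/

theorem hasFDerivAt_inv_norm_sq_add_four {m : ℕ} (y : Euc m) :
    HasFDerivAt (fun z : Euc m => (‖z‖ ^ 2 + 4)⁻¹)
      (-(2 * ((‖y‖ ^ 2 + 4)⁻¹) ^ 2) • innerSL ℝ y) y := by
  have h2 : ‖y‖ ^ 2 + 4 ≠ 0 := by positivity
  have h := (hasDerivAt_inv h2).comp_hasFDerivAt y
    (((hasStrictFDerivAt_norm_sq y).hasFDerivAt).add_const 4)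
  refine h.congr_fderiv ?_
  ext v
  simp
  ring

theorem hasFDerivAt_coe_extChartAt_symm {m : ℕ} (x : Sphere m) (y : Euc m) :
    HasFDerivAt (fun z => (((extChartAt (𝓡 m) x).symm z : Sphere m) : Euc (m + 1)))
      ((‖y‖ ^ 2 + 4)⁻¹ • ((4 : ℝ) • (frame x).toContinuousLinearMap) +
        (-(2 * ((‖y‖ ^ 2 + 4)⁻¹) ^ 2) • innerSL ℝ y).smulRight
          ((4 : ℝ) • frame x y + (8 : ℝ) • (x : Euc (m + 1)))) y := by
  simp only [coe_extChartAt_symm]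
  have h1 : HasFDerivAt (fun z => (4 : ℝ) • frame x z + (8 : ℝ) • (x : Euc (m + 1)))
      ((4 : ℝ) • (frame x).toContinuousLinearMap) y :=
    ((frame x).toContinuousLinearMap.hasFDerivAt.const_smul (4 : ℝ)).add_const _
  exact ((hasFDerivAt_inv_norm_sq_add_four y).smul h1).sub_const _

theorem mdifferentiableAt_coe_sphere {m : ℕ} (x : Sphere m) :
    MDifferentiableAt (𝓡 m) 𝓘(ℝ, Euc (m + 1)) (fun z : Sphere m => (z : Euc (m + 1))) x :=
  have := fact_finrank_euc m
  (contMDiff_coe_sphere (m := 1) x).mdifferentiableAt one_ne_zero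

theorem mdifferentiableAt_extChartAt_symm_sphere {m : ℕ} (x : Sphere m) (y : Euc m) :
    MDifferentiableAt 𝓘(ℝ, Euc m) (𝓡 m) (extChartAt (𝓡 m) x).symm y :=
  ((contMDiffOn_extChartAt_symm (n := 1) x).contMDiffAt
    (by rw [extChartAt_target]; exact univ_mem)).mdifferentiableAt one_ne_zero

theorem dIncl_mfderiv {m : ℕ} {E M : Type*} [NormedAddCommGroup E] [NormedSpace ℝ E]
    {H : Type*} [TopologicalSpace H] {I : ModelWithCorners ℝ E H} [TopologicalSpace M]
    [ChartedSpace H M] {φ : M → Sphere m} {x : M} (hφ : MDifferentiableAt I (𝓡 m) φ x)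
    (v : TangentSpace I x) :
    dIncl m (φ x) (mfderiv I (𝓡 m) φ x v) =
      mfderiv I 𝓘(ℝ, Euc (m + 1)) (fun z => (φ z : Euc (m + 1))) x v := by
  have h := mfderiv_comp x (mdifferentiableAt_coe_sphere (φ x)) hφ
  have h2 := congrArg (fun L => L v) h
  exact h2.symm

theorem dIncl_mfderiv_symm {m : ℕ} (x : Sphere m) (y v : Euc m) :
    dIncl m ((extChartAt (𝓡 m) x).symm y)
        (mfderiv 𝓘(ℝ, Euc m) (𝓡 m) (extChartAt (𝓡 m) x).symm y v) =
      (4 * (‖y‖ ^ 2 + 4)⁻¹) • frame x v - (2 * ((‖y‖ ^ 2 + 4)⁻¹) ^ 2 * inner ℝ y v) •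
          ((4 : ℝ) • frame x y + (8 : ℝ) • (x : Euc (m + 1))) := by
  refine (dIncl_mfderiv (mdifferentiableAt_extChartAt_symm_sphere x y) v).trans ?_
  rw [mfderiv_eq_fderiv]
  refine (congrArg (fun L => L v) (hasFDerivAt_coe_extChartAt_symm x y).fderiv).trans ?_
  simp [smul_smul]
  module

theorem mfderiv_sphere_eq_fderiv {m : ℕ} {F : Type*} [NormedAddCommGroup F] [NormedSpace ℝ F]
    {f : Sphere m → F} {x : Sphere m} (hf : MDifferentiableAt (𝓡 m) 𝓘(ℝ, F) f x) (v : Euc m) :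
    mfderiv (𝓡 m) 𝓘(ℝ, F) f x v = fderiv ℝ (fun z => f ((extChartAt (𝓡 m) x).symm z)) 0 v := by
  rw [hf.mfderiv]
  have h : (extChartAt (𝓡 m) x x : Euc m) = 0 := extChartAt_self x
  have h2 : Set.range (𝓡 m) = Set.univ := by simp
  rw [h2, fderivWithin_univ, h]
  rfl

theorem dIncl_eq_frame {m : ℕ} (x : Sphere m) (v : Euc m) : dIncl m x v = frame x v := by
  refine (mfderiv_sphere_eq_fderiv (mdifferentiableAt_coe_sphere x) v).trans ?_
  rw [(hasFDerivAt_coe_extChartAt_symm x 0).fderiv]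
  simp [smul_smul]
  rfl

theorem inner_basisVec {m : ℕ} (i j : Fin m) :
    inner ℝ (basisVec i) (basisVec j) = (1 : Matrix (Fin m) (Fin m) ℝ) i j := by
  simp [basisVec, PiLp.inner_apply, Matrix.one_apply, eq_comm]

theorem inner_basisVec_right {m : ℕ} (y : Euc m) (j : Fin m) : inner ℝ y (basisVec j) = y j := by
  simp [basisVec, PiLp.inner_apply]

/-- Stereographic projection is conformal. With this scaling the metric is the identity at the
origin and its first derivatives vanish there, which removes the Christoffel symbols from the later
computations. -/
theorem metricCoeff_roundMetric {m : ℕ} (x : Sphere m) (y : Euc m) :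
    metricCoeff (roundMetric m) x y = (16 * ((‖y‖ ^ 2 + 4)⁻¹) ^ 2) • (1 : Matrix (Fin m) (Fin m) ℝ) := by
  ext i j
  have h2 : ‖y‖ ^ 2 + 4 ≠ 0 := by positivity
  refine (roundInner_apply _ _ _ _).trans ?_
  rw [dIncl_mfderiv_symm, dIncl_mfderiv_symm]
  have hx : inner ℝ (x : Euc (m + 1)) (x : Euc (m + 1)) = (1 : ℝ) := by simp
  have hx' : ∀ z, inner ℝ (x : Euc (m + 1)) (frame x z) = 0 := fun z => by
    rw [real_inner_comm, inner_frame_self]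
  have hy : ∀ i, inner ℝ (basisVec i) y = y i := fun i => by
    rw [real_inner_comm, inner_basisVec_right]
  simp only [inner_sub_left, inner_sub_right, inner_smul_left, inner_smul_right, inner_add_left,
    inner_add_right, LinearIsometry.inner_map_map, inner_frame_self, hx', hx, hy,
    inner_basisVec_right, real_inner_self_eq_norm_sq, RCLike.conj_to_real, Matrix.smul_apply, smul_eq_mul, ← inner_basisVec]
  field_simp
  ring

theorem inv_smul_one_matrix {m : ℕ} {r : ℝ} (hr : r ≠ 0) :
    (r • (1 : Matrix (Fin m) (Fin m) ℝ))⁻¹ = r⁻¹ • 1 := by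
  apply Matrix.inv_eq_left_inv
  rw [Matrix.smul_mul, Matrix.mul_smul, smul_smul, inv_mul_cancel₀ hr, one_smul, Matrix.one_mul]

theorem invMetric_roundMetric {m : ℕ} (x : Sphere m) : invMetric (roundMetric m) x = 1 := by
  have h : (extChartAt (𝓡 m) x x : Euc m) = 0 := extChartAt_self x
  rw [invMetric, h, metricCoeff_roundMetric, inv_smul_one_matrix (by positivity)]
  norm_num

theorem christoffel_roundMetric {m : ℕ} (x : Sphere m) (k i j : Fin m) (y : Euc m) :
    christoffel (metricCoeff (roundMetric m) x) k i j y =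
      (-2 * (‖y‖ ^ 2 + 4)⁻¹) * ((1 : Matrix (Fin m) (Fin m) ℝ) j k * y i +
        (1 : Matrix (Fin m) (Fin m) ℝ) i k * y j - (1 : Matrix (Fin m) (Fin m) ℝ) i j * y k) := by
  have h2 : ‖y‖ ^ 2 + 4 ≠ 0 := by positivity
  have hd : ∀ i a b : Fin m, partialD i (fun z => metricCoeff (roundMetric m) x z a b) y =
      -64 * ((‖y‖ ^ 2 + 4)⁻¹) ^ 3 * y i * (1 : Matrix (Fin m) (Fin m) ℝ) a b := by
    intro i a b
    simp only [metricCoeff_roundMetric, Matrix.smul_apply, smul_eq_mul]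
    have h := (((hasFDerivAt_inv_norm_sq_add_four y).pow 2).const_mul 16).mul_const
      ((1 : Matrix (Fin m) (Fin m) ℝ) a b)
    rw [partialD, h.fderiv]
    simp [inner_basisVec_right]
    field_simp
    ring
  simp only [christoffel, hd]
  rw [metricCoeff_roundMetric, inv_smul_one_matrix (by positivity)]
  simp only [Matrix.smul_apply, smul_eq_mul, Matrix.one_apply (i := k), mul_ite, ite_mul, mul_one,
    mul_zero, zero_mul, Finset.sum_ite_eq, Finset.mem_univ, if_true]
  field_simp
  ring

theorem christoffel_roundMetric_zero {m : ℕ} (x : Sphere m) (k i j : Fin m) :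
    christoffel (metricCoeff (roundMetric m) x) k i j 0 = 0 := by
  simp [christoffel_roundMetric]

theorem partialD_christoffel_roundMetric_zero {m : ℕ} (x : Sphere m) (k i j l : Fin m) :
    partialD l (christoffel (metricCoeff (roundMetric m) x) k i j) 0 =
      -(1 / 2) * ((1 : Matrix (Fin m) (Fin m) ℝ) j k * (1 : Matrix (Fin m) (Fin m) ℝ) i l +
        (1 : Matrix (Fin m) (Fin m) ℝ) i k * (1 : Matrix (Fin m) (Fin m) ℝ) j l -
        (1 : Matrix (Fin m) (Fin m) ℝ) i j * (1 : Matrix (Fin m) (Fin m) ℝ) k l) := by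
  have hc := funext (christoffel_roundMetric x k i j)
  rw [partialD, hc]
  have hy : ∀ i : Fin m, HasFDerivAt (fun y : Euc m => y i) (EuclideanSpace.proj i : Euc m →L[ℝ] ℝ) 0 :=
    fun i => (EuclideanSpace.proj i : Euc m →L[ℝ] ℝ).hasFDerivAt
  have h := ((hasFDerivAt_inv_norm_sq_add_four (0 : Euc m)).const_mul (-2)).mul
    ((((hy i).const_mul ((1 : Matrix (Fin m) (Fin m) ℝ) j k)).add
      ((hy j).const_mul ((1 : Matrix (Fin m) (Fin m) ℝ) i k))).sub
      ((hy k).const_mul ((1 : Matrix (Fin m) (Fin m) ℝ) i j)))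
  refine (congrArg (fun L => L (basisVec l)) h.fderiv).trans ?_
  simp [basisVec]
  simp only [Matrix.one_apply]
  norm_num

/-- At the centre of the chart the quadratic Christoffel terms vanish, so only the derivatives of
the symbols contribute to the trace. -/
theorem ricciAt_roundMetric {m : ℕ} (x : Sphere m) (j k : Fin m) :
    ricciAt (roundMetric m) x j k = ((m : ℝ) - 1) * (1 : Matrix (Fin m) (Fin m) ℝ) j k := by
  have h : (extChartAt (𝓡 m) x x : Euc m) = 0 := extChartAt_self x
  have hs : ∀ i : Fin m, (1 : Matrix (Fin m) (Fin m) ℝ) i i = 1 := fun i => Matrix.one_apply_eq i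
  have hsymm : ∀ i j : Fin m, (1 : Matrix (Fin m) (Fin m) ℝ) i j * (1 : Matrix (Fin m) (Fin m) ℝ) i k =
      if i = j then (1 : Matrix (Fin m) (Fin m) ℝ) j k else 0 := by
    intro i j
    rw [Matrix.one_apply (i := i) (j := j)]
    split_ifs with h
    · rw [h, one_mul]
    · rw [zero_mul]
  rw [ricciAt, h, ricci]
  simp only [curvature, partialD_christoffel_roundMetric_zero, christoffel_roundMetric_zero,
    zero_mul, sub_zero, Finset.sum_const_zero, add_zero, hs]
  have hc : ∀ a b : Fin m, (1 : Matrix (Fin m) (Fin m) ℝ) a b = (1 : Matrix (Fin m) (Fin m) ℝ) b a := by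
    intro a b; simp [Matrix.one_apply, eq_comm]
  have : ∀ i : Fin m, -(1 / 2) * ((1 : Matrix (Fin m) (Fin m) ℝ) k i * (1 : Matrix (Fin m) (Fin m) ℝ) j i +
      (1 : Matrix (Fin m) (Fin m) ℝ) j i * (1 : Matrix (Fin m) (Fin m) ℝ) k i -
      (1 : Matrix (Fin m) (Fin m) ℝ) j k * 1) -
      -(1 / 2) * ((1 : Matrix (Fin m) (Fin m) ℝ) k i * (1 : Matrix (Fin m) (Fin m) ℝ) i j +
      1 * (1 : Matrix (Fin m) (Fin m) ℝ) k j - (1 : Matrix (Fin m) (Fin m) ℝ) i k *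
        (1 : Matrix (Fin m) (Fin m) ℝ) i j) =
      (1 : Matrix (Fin m) (Fin m) ℝ) j k - (1 : Matrix (Fin m) (Fin m) ℝ) i j * (1 : Matrix (Fin m) (Fin m) ℝ) i k := by
    intro i
    rw [hc k i, hc j i, hc k j]
    ring
  simp only [this, hsymm, Finset.sum_sub_distrib, Finset.sum_ite_eq', Finset.mem_univ, if_true]
  simp
  ring

theorem scal_roundMetric {m : ℕ} (x : Sphere m) : scal (roundMetric m) x = m * ((m : ℝ) - 1) := by
  simp [scal, invMetric_roundMetric, ricciAt_roundMetric, Matrix.one_apply]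
  ring

/-! ### The energy terms of a self-map of the round sphere. -/

theorem normSqDifferential_roundMetric {m : ℕ} (φ : Sphere m → Sphere m) (x : Sphere m) :
    normSqDifferential (m := m) (n := m) (roundMetric m) (roundMetric m) φ x =
      ∑ i, pullbackCoeff (m := m) (n := m) (roundMetric m) φ x i i := by
  simp [normSqDifferential, invMetric_roundMetric, Matrix.one_apply]

theorem traceRicci_roundMetric {m : ℕ} (φ : Sphere m → Sphere m) (x : Sphere m) :
    traceRicci (m := m) (n := m) (roundMetric m) (roundMetric m) φ x =
      ((m : ℝ) - 1) * ∑ i, pullbackCoeff (m := m) (n := m) (roundMetric m) φ x i i := by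
  simp [traceRicci, invMetric_roundMetric, ricciAt_roundMetric, Matrix.one_apply, Finset.mul_sum]

theorem pullbackCoeff_roundMetric {m : ℕ} {φ : Sphere m → Sphere m} {x : Sphere m}
    (hφ : MDifferentiableAt (𝓡 m) (𝓡 m) φ x) (i j : Fin m) :
    pullbackCoeff (m := m) (n := m) (roundMetric m) φ x i j =
      inner ℝ
        (fderiv ℝ (fun z => (φ ((extChartAt (𝓡 m) x).symm z) : Euc (m + 1))) 0 (basisVec i))
        (fderiv ℝ (fun z => (φ ((extChartAt (𝓡 m) x).symm z) : Euc (m + 1))) 0 (basisVec j)) := by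
  refine (roundInner_apply _ _ _ _).trans ?_
  have hc : MDifferentiableAt (𝓡 m) 𝓘(ℝ, Euc (m + 1)) (fun z => (φ z : Euc (m + 1))) x :=
    (mdifferentiableAt_coe_sphere (φ x)).comp x hφ
  exact congrArg₂ _ 
    ((dIncl_mfderiv hφ _).trans (mfderiv_sphere_eq_fderiv hc _))
    ((dIncl_mfderiv hφ _).trans (mfderiv_sphere_eq_fderiv hc _))

/-- Both charts are centred, so both sets of Christoffel symbols vanish and both metrics are the
identity: the tension is the flat Laplacian of the local map, and `frame` preserves its norm. -/
theorem norm_sq_tension_roundMetric {m : ℕ} (φ : Sphere m → Sphere m) (x : Sphere m) :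
    (roundMetric m).inner (φ x) (tension (m := m) (n := m) (roundMetric m) (roundMetric m) φ x)
      (tension (m := m) (n := m) (roundMetric m) (roundMetric m) φ x) =
      ∑ a, (∑ i, partialD i (partialD i (localMap (m := m) (n := m) φ x a)) (0 : Euc m)) ^ 2 := by
  refine (roundInner_apply _ _ _ _).trans ?_
  refine (congrArg₂ _ (dIncl_eq_frame _ _) (dIncl_eq_frame _ _)).trans ?_
  have key : ∀ w : Euc m, inner ℝ (frame (φ x) w) (frame (φ x) w) = ∑ a, w a ^ 2 := fun w => by
    rw [(frame (φ x)).inner_map_map, real_inner_self_eq_norm_sq, EuclideanSpace.real_norm_sq_eq]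
  refine (key _).trans ?_
  have h : (extChartAt (𝓡 m) x x : Euc m) = 0 := extChartAt_self x
  have h' : (extChartAt (𝓡 m) (φ x) (φ x) : Euc m) = 0 := extChartAt_self _
  refine Finset.sum_congr rfl fun a _ => congrArg (· ^ 2) ?_
  simp only [tension, h, h', christoffel_roundMetric_zero, invMetric_roundMetric]
  simp [Matrix.one_apply]

/-- Parseval in x^⊥: the frame vectors form an orthonormal basis of it, and the right-hand side
pairs the projections of a and b. -/
theorem sum_inner_frame {m : ℕ} (x : Sphere m) (a b : Euc (m + 1)) :
    ∑ i, inner ℝ (frame x (basisVec i)) a * inner ℝ (frame x (basisVec i)) b =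
      inner ℝ a b - inner ℝ a (x : Euc (m + 1)) * inner ℝ b (x : Euc (m + 1)) := by
  have hproj : ∀ a : Euc (m + 1), ((Submodule.span ℝ {((-x : Sphere m) : Euc (m + 1))})ᗮ).starProjection a
      = a - inner ℝ (x : Euc (m + 1)) a • (x : Euc (m + 1)) := by
    intro a
    have h4 : ((-x : Sphere m) : Euc (m + 1)) = -(x : Euc (m+1)) := rfl
    rw [Submodule.starProjection_orthogonal']
    simp only [sub_apply, one_apply_eq_self]
    rw [Submodule.starProjection_unit_singleton ℝ (by simp), h4]
    simp
  have h : ∀ (a : Euc (m + 1)) (i : Fin m), inner ℝ (frame x (basisVec i)) a =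
      (complementRepr x
        (((Submodule.span ℝ {((-x : Sphere m) : Euc (m + 1))})ᗮ).orthogonalProjectionOnto a) : Euc m) i := by
    intro a i
    rw [complementRepr_apply, ← Submodule.starProjection_apply, hproj, inner_sub_right,
      inner_smul_right, inner_frame_self]
    ring
  simp only [h]
  have h2 : ∀ v w : Euc m, ∑ i, v i * w i = inner ℝ v w := fun v w => by
    simp [PiLp.inner_apply, mul_comm]
  rw [h2, LinearIsometryEquiv.inner_map_map, Submodule.coe_inner, ← Submodule.starProjection_apply,
    ← Submodule.starProjection_apply, hproj, hproj]
  have hx : inner ℝ (x : Euc (m + 1)) (x : Euc (m + 1)) = (1 : ℝ) := by simp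
  simp only [inner_sub_left, inner_sub_right, inner_smul_left, inner_smul_right, hx,
    RCLike.conj_to_real, real_inner_comm (x : Euc (m + 1))]
  ring

/-! ### Second derivatives of quotients of quadratic polynomials -/

theorem hasFDerivAt_real_div {E : Type*} [NormedAddCommGroup E] [NormedSpace ℝ E] {f g : E → ℝ}
    {f' g' : E →L[ℝ] ℝ} {y : E} (hf : HasFDerivAt f f' y) (hg : HasFDerivAt g g' y)
    (h : g y ≠ 0) :
    HasFDerivAt (fun z => f z / g z) ((g y ^ 2)⁻¹ • (g y • f' - f y • g')) y := by
  have h1 := hf.mul ((hasDerivAt_inv h).comp_hasFDerivAt y hg)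
  refine HasFDerivAt.congr_fderiv (f := fun z => f z / g z) h1 ?_
  ext v
  simp
  field_simp
  ring

/-- The numerator vanishes at 0, so the quadratic part of the denominator enters the quotient only
at third order; hence b is absent from the result. -/
theorem partialD_partialD_quadratic_div {m : ℕ} (P Q : Euc m →L[ℝ] ℝ) (a b q : ℝ) (hq : q ≠ 0)
    (i : Fin m) :
    partialD i (partialD i fun y : Euc m => (P y + a * ‖y‖ ^ 2) / (q + Q y + b * ‖y‖ ^ 2)) 0 =
      2 * a / q - 2 * P (basisVec i) * Q (basisVec i) / q ^ 2 := by
  have hnum : ∀ y, HasFDerivAt (fun y : Euc m => P y + a * ‖y‖ ^ 2) (P + a • (2 • innerSL ℝ y)) y :=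
    fun y => P.hasFDerivAt.add ((hasStrictFDerivAt_norm_sq y).hasFDerivAt.const_mul a)
  have hden : ∀ y, HasFDerivAt (fun y : Euc m => q + Q y + b * ‖y‖ ^ 2)
      (Q + b • (2 • innerSL ℝ y)) y :=
    fun y => (Q.hasFDerivAt.const_add q).add ((hasStrictFDerivAt_norm_sq y).hasFDerivAt.const_mul b)
  have hev : ∀ᶠ y in 𝓝 (0 : Euc m), q + Q y + b * ‖y‖ ^ 2 ≠ 0 :=
    (hden 0).continuousAt.eventually_ne (by simpa using hq)
  have h1 : partialD i (fun y : Euc m => (P y + a * ‖y‖ ^ 2) / (q + Q y + b * ‖y‖ ^ 2)) =ᶠ[𝓝 0]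
      fun y => ((P (basisVec i) + 2 * a * y i) * (q + Q y + b * ‖y‖ ^ 2) -
        (P y + a * ‖y‖ ^ 2) * (Q (basisVec i) + 2 * b * y i)) / (q + Q y + b * ‖y‖ ^ 2) ^ 2 := by
    filter_upwards [hev] with y hy
    rw [partialD, (hasFDerivAt_real_div (hnum y) (hden y) hy).fderiv]
    simp [inner_basisVec_right]
    field_simp
  have hy : HasFDerivAt (fun y : Euc m => y i) (EuclideanSpace.proj i : Euc m →L[ℝ] ℝ) 0 :=
    (EuclideanSpace.proj i : Euc m →L[ℝ] ℝ).hasFDerivAt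
  have h2 := hasFDerivAt_real_div ((((hy.const_mul (2 * a)).const_add (P (basisVec i))).mul (hden 0)).sub
    ((hnum 0).mul ((hy.const_mul (2 * b)).const_add (Q (basisVec i))))) ((hden 0).pow 2)
      (by simpa using hq)
  rw [partialD, h1.fderiv_eq]
  refine (congrArg (fun L => L (basisVec i)) h2.fderiv).trans ?_
  simp [basisVec]
  field_simp
  ring

/-! ### The maps `φ_t` as projective maps -/

/-- The last basis vector, i.e. the north pole. -/
def pole (m : ℕ) : Euc (m + 1) := basisVec (Fin.last m)

theorem inner_pole {m : ℕ} (v : Euc (m + 1)) : inner ℝ v (pole m) = v (Fin.last m) :=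
  inner_basisVec_right v _

/-- The parameter `(1 - t²) / (1 + t²)`. -/
def speed (t : ℝ) : ℝ := (1 - t ^ 2) / (1 + t ^ 2)

/-- The parameter `2t / (1 + t²)`. -/
def contraction (t : ℝ) : ℝ := 2 * t / (1 + t ^ 2)

theorem contraction_sq (t : ℝ) : contraction t ^ 2 = 1 - speed t ^ 2 := by
  have : 1 + t ^ 2 ≠ 0 := by positivity
  simp only [contraction, speed]
  field_simp
  ring

theorem contraction_pos {t : ℝ} (ht : 0 < t) : 0 < contraction t := by
  unfold contraction; positivity

theorem abs_speed_lt_one {t : ℝ} (ht : 0 < t) : |speed t| < 1 := by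
  rw [← sq_lt_one_iff_abs_lt_one]
  nlinarith [contraction_sq t, pow_pos (contraction_pos ht) 2]

theorem one_add_mul_pos {u s : ℝ} (hu : |u| < 1) (hs : s ∈ Set.Icc (-1 : ℝ) 1) : 0 < 1 + u * s := by
  have h1 := abs_le.2 hs
  have h : |u * s| < 1 := by
    rw [abs_mul]
    nlinarith [abs_nonneg u, abs_nonneg s]
  linarith [(abs_lt.1 h).1]

theorem abs_coord_le_one {m : ℕ} (x : Sphere m) (i : Fin (m + 1)) : |(x : Euc (m + 1)) i| ≤ 1 := by
  have h := PiLp.norm_apply_le (x : Euc (m + 1)) i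
  simpa using h

theorem one_add_mul_last_pos {m : ℕ} {u : ℝ} (hu : |u| < 1) (x : Sphere m) :
    0 < 1 + u * (x : Euc (m + 1)) (Fin.last m) :=
  one_add_mul_pos hu (abs_le.1 (abs_coord_le_one x _))

theorem norm_sq_horizontal {m : ℕ} (x : Euc (m + 1)) :
    ‖horizontal x‖ ^ 2 = ‖x‖ ^ 2 - x (Fin.last m) ^ 2 := by
  rw [EuclideanSpace.real_norm_sq_eq, EuclideanSpace.real_norm_sq_eq, Fin.sum_univ_castSucc]
  simp [horizontal]

/-- This closed form replaces the trigonometric definition everywhere below. Away from the poles it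
is the half-angle formula for tan(α/2) = t tan(r/2). -/
theorem coe_phi {m : ℕ} {t : ℝ} (ht : 0 < t) (x : Sphere m) :
    (phi m t x : Euc (m + 1)) = (1 + speed t * (x : Euc (m + 1)) (Fin.last m))⁻¹ •
      (contraction t • (x : Euc (m + 1)) +
        ((1 - contraction t) * (x : Euc (m + 1)) (Fin.last m) + speed t) • pole m) := by
  have hpos := (one_add_mul_last_pos (abs_speed_lt_one ht) x).ne'
  have hn := norm_sq_horizontal (x : Euc (m + 1))
  rw [show ‖(x : Euc (m + 1))‖ = 1 by simp] at hn
  change phiVec t (x : Euc (m + 1)) = _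
  unfold phiVec
  have hp1 : ∀ i : Fin m, pole m i.castSucc = 0 := fun i => by
    simp [pole, basisVec]
  have hp2 : pole m (Fin.last m) = 1 := by simp [pole, basisVec]
  set c := (x : Euc (m + 1)) (Fin.last m) with hc
  have htt : 1 + t ^ 2 ≠ 0 := by positivity
  split_ifs with h
  -- At a pole c² = 1, and the projective formula fixes the point.
  · rw [h] at hn
    have hc1 : c ^ 2 = 1 := by simp at hn; linarith
    ext j
    refine Fin.lastCases ?_ (fun i => ?_) j
    · simp only [PiLp.smul_apply, PiLp.add_apply, hp2, smul_eq_mul, ← hc]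
      rw [inv_mul_eq_div, eq_div_iff hpos]
      linear_combination speed t * hc1
    · have : (x : Euc (m + 1)) i.castSucc = 0 := congrArg (fun v : Euc m => v i) h
      simp [hp1, this]
  · have hs : 0 < ‖horizontal (x : Euc (m + 1))‖ := norm_pos_iff.2 h
    have hcabs : c ^ 2 < 1 := by nlinarith
    have hc' := (sq_lt_one_iff_abs_lt_one _).1 hcabs
    have hc1 := (abs_lt.1 hc').1
    have hc2 := (abs_lt.1 hc').2
    have hcos : Real.cos (Real.arccos c) = c := Real.cos_arccos hc1.le hc2.le
    set r := Real.arccos c with hr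
    have hr0 : 0 < r := Real.arccos_pos.2 hc2
    have hrpi : r < Real.pi := Real.arccos_lt_pi.2 hc1
    have hC : 0 < Real.cos (r / 2) := Real.cos_pos_of_mem_Ioo ⟨by linarith, by linarith⟩
    have hS : 0 < Real.sin (r / 2) := Real.sin_pos_of_pos_of_lt_pi (by linarith) (by linarith)
    have hCS := Real.sin_sq_add_cos_sq (r / 2)
    have hcc : c = 2 * Real.cos (r / 2) ^ 2 - 1 := by
      rw [← hcos, ← Real.cos_two_mul]; ring_nf
    have hnorm : ‖horizontal (x : Euc (m + 1))‖ = 2 * Real.sin (r / 2) * Real.cos (r / 2) := by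
      rw [← abs_of_pos hs, ← abs_of_pos (by positivity : 0 < 2 * Real.sin (r / 2) * Real.cos (r / 2)),
        ← sq_eq_sq_iff_abs_eq_abs, hn, hcc]
      linear_combination (-4 * Real.cos (r / 2) ^ 2) * hCS
    have hcosA : Real.cos (alpha t r) = 2 * (1 / (1 + (t * Real.tan (r / 2)) ^ 2)) - 1 := by
      rw [alpha, Real.cos_two_mul, Real.cos_sq_arctan]
    have hsinA : Real.sin (alpha t r) =
        2 * (t * Real.tan (r / 2)) * (1 / (1 + (t * Real.tan (r / 2)) ^ 2)) := by
      rw [alpha, Real.sin_two_mul, ← Real.cos_sq_arctan]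
      have := Real.tan_mul_cos (Real.cos_arctan_pos (t * Real.tan (r / 2))).ne'
      rw [Real.tan_arctan] at this
      rw [← this]; ring
    have hd1 : Real.cos (r / 2) ^ 2 + t ^ 2 * Real.sin (r / 2) ^ 2 ≠ 0 := by positivity
    have hlam : (1 + speed t * c) * (1 + t ^ 2) =
        2 * (Real.cos (r / 2) ^ 2 + t ^ 2 * Real.sin (r / 2) ^ 2) := by
      rw [hcc, speed]; field_simp
      linear_combination (-2 * t ^ 2) * hCS
    have hinv : (1 + speed t * c)⁻¹ =
        (1 + t ^ 2) / (2 * (Real.cos (r / 2) ^ 2 + t ^ 2 * Real.sin (r / 2) ^ 2)) := by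
      rw [← hlam]; field_simp
    have hden : 1 / (1 + (t * Real.tan (r / 2)) ^ 2) =
        Real.cos (r / 2) ^ 2 / (Real.cos (r / 2) ^ 2 + t ^ 2 * Real.sin (r / 2) ^ 2) := by
      rw [Real.tan_eq_sin_div_cos]; field_simp
    rw [hden] at hcosA hsinA
    rw [Real.tan_eq_sin_div_cos] at hsinA
    ext j
    change polar (longitude (x : Euc (m + 1))) (alpha t r) j = _
    refine Fin.lastCases ?_ (fun i => ?_) j
    · simp only [polar, Fin.snoc_last, PiLp.smul_apply, PiLp.add_apply, hp2, smul_eq_mul, ← hc]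
      rw [hcosA, hinv, contraction, speed, hcc]
      field_simp
      linear_combination (-2 * t ^ 2) * hCS
    · simp only [polar, Fin.snoc_castSucc, PiLp.smul_apply, PiLp.add_apply, hp1, smul_eq_mul,
        longitude, horizontal]
      change _ * (‖horizontal (x : Euc (m + 1))‖⁻¹ * _) = _
      rw [hsinA, hinv, hnorm, contraction]
      field_simp
      ring

/-- The projective formula is smooth on the open set of the ambient space where its denominator is
nonzero, and that set contains the sphere, poles included. -/
theorem contMDiff_phi {m : ℕ} {t : ℝ} (ht : 0 < t) : ContMDiff (𝓡 m) (𝓡 m) ∞ (phi m t) := by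
  have := fact_finrank_euc m
  have h1 : ContMDiff (𝓡 m) 𝓘(ℝ, Euc (m + 1)) ∞ (fun x : Sphere m => (x : Euc (m + 1))) :=
    contMDiff_coe_sphere
  have h2 : ContMDiff (𝓡 m) 𝓘(ℝ, Euc (m + 1)) ∞ (fun x : Sphere m => (phi m t x : Euc (m + 1))) := by
    intro x
    have hlast : ContDiff ℝ ∞ (fun z : Euc (m + 1) => z (Fin.last m)) :=
      (EuclideanSpace.proj (Fin.last m) : Euc (m + 1) →L[ℝ] ℝ).contDiff
    have h3 : ContDiffAt ℝ ∞ (fun z : Euc (m + 1) => (1 + speed t * z (Fin.last m))⁻¹ •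
      (contraction t • z + ((1 - contraction t) * z (Fin.last m) + speed t) • pole m)) x := by
      refine ContDiffAt.smul (ContDiffAt.inv (𝕜 := ℝ) (𝕜' := ℝ) ?_ ?_) ?_
      · exact (contDiff_const.add (contDiff_const.mul hlast)).contDiffAt
      · exact (one_add_mul_last_pos (abs_speed_lt_one ht) x).ne'
      · exact ((contDiff_id.const_smul _).add
          (((contDiff_const.mul hlast).add contDiff_const).smul contDiff_const)).contDiffAt
    have h4 := h3.contMDiffAt.comp x (h1 x)
    refine h4.congr_of_eventuallyEq (Eventually.of_forall fun z => ?_)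
    exact coe_phi ht z
  exact h2.codRestrict_sphere _

/-! ### The energy density of `φ_t` -/

theorem inner_self_sphere {m : ℕ} (x : Sphere m) :
    inner ℝ (x : Euc (m + 1)) (x : Euc (m + 1)) = (1 : ℝ) := by simp

theorem pole_last (m : ℕ) : pole m (Fin.last m) = 1 := by simp [pole, basisVec]

theorem inner_pole_left {m : ℕ} (v : Euc (m + 1)) : inner ℝ (pole m) v = v (Fin.last m) := by
  rw [real_inner_comm, inner_pole]

theorem mdifferentiableAt_phi {m : ℕ} {t : ℝ} (ht : 0 < t) (x : Sphere m) :
    MDifferentiableAt (𝓡 m) (𝓡 m) (phi m t) x :=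
  (contMDiff_phi ht).mdifferentiable (by simp) x

theorem fderiv_coe_phi {m : ℕ} {t : ℝ} (ht : 0 < t) (x : Sphere m) (v : Euc m) :
    fderiv ℝ (fun z => (phi m t ((extChartAt (𝓡 m) x).symm z) : Euc (m + 1))) 0 v =
      (1 + speed t * (x : Euc (m + 1)) (Fin.last m))⁻¹ •
        (contraction t • frame x v + ((1 - contraction t) * frame x v (Fin.last m)) • pole m) -
      (((1 + speed t * (x : Euc (m + 1)) (Fin.last m))⁻¹) ^ 2 *
        (speed t * frame x v (Fin.last m))) •
        (contraction t • (x : Euc (m + 1)) +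
        ((1 - contraction t) * (x : Euc (m + 1)) (Fin.last m) + speed t) • pole m) := by
  have h := hasFDerivAt_coe_extChartAt_symm x 0
  have hx : (((extChartAt (𝓡 m) x).symm 0 : Sphere m) : Euc (m + 1)) = x := by
    rw [← extChartAt_self x, extChartAt_to_inv]
  have hd := one_add_mul_last_pos (abs_speed_lt_one ht) x
  have hl := (EuclideanSpace.proj (Fin.last m) : Euc (m + 1) →L[ℝ] ℝ).hasFDerivAt.comp (0 : Euc m) h
  have h1 : HasFDerivAt (fun z => 1 + speed t *
      (((extChartAt (𝓡 m) x).symm z : Sphere m) : Euc (m + 1)) (Fin.last m)) _ 0 :=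
    (hl.const_mul (speed t)).const_add 1
  have h2 := (hasDerivAt_inv (𝕜 := ℝ) (x := 1 + speed t *
      (((extChartAt (𝓡 m) x).symm 0 : Sphere m) : Euc (m + 1)) (Fin.last m))
      (by rw [hx]; exact hd.ne')).comp_hasFDerivAt (0 : Euc m) h1
  have h3 := (h.const_smul (contraction t)).add (((hl.const_mul (1 - contraction t)).add_const
    (speed t)).smul_const (pole m))
  have h4 := h2.smul h3
  have h5 : (fun z => (phi m t ((extChartAt (𝓡 m) x).symm z) : Euc (m + 1))) = _ :=
    funext fun z => coe_phi ht ((extChartAt (𝓡 m) x).symm z)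
  rw [h5]
  refine (congrArg (fun L => L v) h4.fderiv).trans ?_
  have hx' := hx
  simp only [mfld_simps] at hx'
  simp [hx', smul_smul]
  module

/-- The diagonal entries of the conformal factor are enough, since the inverse metric and the Ricci
tensor are multiples of the identity at the centre. -/
theorem pullbackCoeff_phi {m : ℕ} {t : ℝ} (ht : 0 < t) (x : Sphere m) (i : Fin m) :
    pullbackCoeff (m := m) (n := m) (roundMetric m) (phi m t) x i i =
      contraction t ^ 2 / (1 + speed t * (x : Euc (m + 1)) (Fin.last m)) ^ 2 := by
  rw [pullbackCoeff_roundMetric (mdifferentiableAt_phi ht x)]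
  rw [fderiv_coe_phi ht]
  have hd := (one_add_mul_last_pos (abs_speed_lt_one ht) x).ne'
  have h1 := inner_frame_self x (basisVec i)
  have h2 : inner ℝ (frame x (basisVec i)) (frame x (basisVec i)) = (1 : ℝ) := by
    rw [LinearIsometry.inner_map_map, inner_basisVec, Matrix.one_apply_eq]
  have h3 : inner ℝ (x : Euc (m + 1)) (frame x (basisVec i)) = 0 := by rw [real_inner_comm, h1]
  have hw := contraction_sq t
  simp only [inner_sub_left, inner_sub_right, inner_smul_left, inner_smul_right, inner_add_left,
    inner_add_right, RCLike.conj_to_real, h1, h2, h3, inner_pole_left, pole_last, inner_pole, inner_self_sphere]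
  generalize frame x (basisVec i) (Fin.last m) = a
  generalize (x : Euc (m + 1)) (Fin.last m) = c at *
  generalize speed t = u at *
  generalize contraction t = w at *
  field_simp
  linear_combination (a ^ 2 * (u ^ 2 - 1)) * hw

/-- The second-order coefficient of the denominator of `φ_t` in stereographic coordinates. -/
def denomCoeff (u c : ℝ) : ℝ := (1 - u * c) + (2 * u ^ 2 - 1 - u ^ 2 * c ^ 2) / (1 + u * c)

/-- A projective map read in two stereographic charts is a quotient of quadratic polynomials. The
numerator has no constant term because the charts are centred at x and at its image. -/
theorem localMap_phi {m : ℕ} {t : ℝ} (ht : 0 < t) (x : Sphere m) (a : Fin m) :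
    localMap (m := m) (n := m) (phi m t) x a = fun y : Euc m =>
      (((8 : ℝ) • ((contraction t) • innerSL ℝ (frame (phi m t x) (basisVec a)) +
        ((1 - contraction t) * frame (phi m t x) (basisVec a) (Fin.last m)) •
          innerSL ℝ (pole m)).comp (frame x).toContinuousLinearMap) y +
        4 * speed t * frame (phi m t x) (basisVec a) (Fin.last m) * ‖y‖ ^ 2) /
      (8 * (1 + speed t * (x : Euc (m + 1)) (Fin.last m)) +
        ((8 * speed t) • (innerSL ℝ (pole m)).comp (frame x).toContinuousLinearMap) y +
        denomCoeff (speed t) ((x : Euc (m + 1)) (Fin.last m)) * ‖y‖ ^ 2) := by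
  funext y
  have hd := (one_add_mul_last_pos (abs_speed_lt_one ht) x).ne'
  have hdz := (one_add_mul_last_pos (abs_speed_lt_one ht) ((extChartAt (𝓡 m) x).symm y)).ne'
  have hq : ‖y‖ ^ 2 + 4 ≠ 0 := by positivity
  have hp := inner_frame_self (phi m t x) (basisVec a)
  have hw := contraction_sq t
  rw [coe_phi ht, inner_smul_right, mul_eq_zero, or_iff_right (inv_ne_zero hd), inner_add_right,
    inner_smul_right, inner_smul_right, inner_pole] at hp
  change (extChartAt (𝓡 m) (phi m t x) (phi m t ((extChartAt (𝓡 m) x).symm y)) : Euc m) a = _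
  rw [extChartAt_apply, coe_phi ht, coe_phi ht ((extChartAt (𝓡 m) x).symm y), ← mul_div_right_comm]
  have hZ := congrArg (fun v : Euc (m + 1) => v (Fin.last m)) (coe_extChartAt_symm x y)
  have hxZ := congrArg (fun v : Euc (m + 1) => inner ℝ (x : Euc (m + 1)) v) (coe_extChartAt_symm x y)
  have hbZ := congrArg (fun v => inner ℝ (frame (phi m t x) (basisVec a)) v)
    (coe_extChartAt_symm x y)
  have hJ : inner ℝ (x : Euc (m + 1)) (frame x y) = 0 := by
    rw [real_inner_comm, inner_frame_self]
  simp only [PiLp.sub_apply, PiLp.add_apply, PiLp.smul_apply, smul_eq_mul] at hZ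
  simp only [inner_sub_right, inner_add_right, inner_smul_right, inner_self_sphere, hJ] at hxZ hbZ
  simp only [inner_smul_left, inner_smul_right, inner_add_left,
    inner_add_right, RCLike.conj_to_real, inner_pole_left, pole_last, inner_pole, hxZ, hbZ,
    ContinuousLinearMap.comp_apply, add_apply, smul_apply, smul_eq_mul,
    LinearIsometry.coe_toContinuousLinearMap, innerSL_apply_apply]
  generalize (((extChartAt (𝓡 m) x).symm y : Sphere m) : Euc (m + 1)) (Fin.last m) = Zc at *
  generalize inner ℝ (frame (phi m t x) (basisVec a)) (x : Euc (m + 1)) = bx at *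
  generalize inner ℝ (frame (phi m t x) (basisVec a)) (frame x y) = bJ at *
  generalize frame (phi m t x) (basisVec a) (Fin.last m) = β at *
  generalize frame x y (Fin.last m) = γ at *
  generalize (x : Euc (m + 1)) (Fin.last m) = c at *
  generalize speed t = u at *
  generalize contraction t = w at *
  generalize hqq : ‖y‖ ^ 2 + 4 = q at *
  have hy : ‖y‖ ^ 2 = q - 4 := by linarith
  rw [hy]
  -- Clearing the denominators of the inverse chart and of `φ_t` makes numerator and denominator
  -- polynomial, so they can be compared separately. The numerators agree by orthogonality of the
  -- frame vector to the image point, the denominators by w² = 1 - u².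
  have hK : q * (1 + u * Zc) ≠ 0 := mul_ne_zero hq hdz
  rw [← mul_div_mul_left _ _ hK]
  have hZ' : q * Zc = 4 * γ + 8 * c - q * c := by rw [hZ]; field_simp
  have hK2 : q + u * (4 * γ + 8 * c - q * c) ≠ 0 := by
    rw [← hZ']; convert hK using 1; ring
  subst hZ
  congr 1
  · field_simp
    linear_combination (2 * (8 - q)) * hp
  · rw [denomCoeff]
    field_simp
    linear_combination (8 - q - c * (4 * γ + 8 * c - q * c)) * hw

/-- The |y|² term of the numerator contributes m equal summands. Parseval and the orthogonality of
the target frame to the image point reduce the cross terms to -2 of the same quantity, whence m - 2.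
-/
theorem sum_partialD_localMap_phi {m : ℕ} {t : ℝ} (ht : 0 < t) (x : Sphere m) (a : Fin m) :
    ∑ i, partialD i (partialD i (localMap (m := m) (n := m) (phi m t) x a)) (0 : Euc m) =
      ((m : ℝ) - 2) * speed t * frame (phi m t x) (basisVec a) (Fin.last m) /
        (1 + speed t * (x : Euc (m + 1)) (Fin.last m)) := by
  have hd := (one_add_mul_last_pos (abs_speed_lt_one ht) x).ne'
  simp only [localMap_phi ht]
  simp only [partialD_partialD_quadratic_div _ _ _ _ _ (mul_ne_zero (by norm_num : (8 : ℝ) ≠ 0) hd)]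
  have hp := inner_frame_self (phi m t x) (basisVec a)
  rw [coe_phi ht, inner_smul_right] at hp
  have hp' := (mul_eq_zero.1 hp).resolve_left (inv_ne_zero hd)
  have hb := sum_inner_frame x (frame (phi m t x) (basisVec a)) (pole m)
  have he := sum_inner_frame x (pole m) (pole m)
  rw [inner_add_right, inner_smul_right, inner_smul_right, inner_pole] at hp'
  refine (Finset.sum_congr rfl (g := fun i => speed t * frame (phi m t x) (basisVec a) (Fin.last m) /
      (1 + speed t * (x : Euc (m + 1)) (Fin.last m)) -
      2 * speed t / (1 + speed t * (x : Euc (m + 1)) (Fin.last m)) ^ 2 *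
      (contraction t * (inner ℝ (frame x (basisVec i)) (frame (phi m t x) (basisVec a)) *
        inner ℝ (frame x (basisVec i)) (pole m)) + (1 - contraction t) *
        frame (phi m t x) (basisVec a) (Fin.last m) *
        (inner ℝ (frame x (basisVec i)) (pole m) * inner ℝ (frame x (basisVec i)) (pole m)))) fun i _ => ?_).trans ?_
  · simp only [ContinuousLinearMap.comp_apply, add_apply, smul_apply,
      smul_eq_mul, LinearIsometry.coe_toContinuousLinearMap, innerSL_apply_apply, inner_pole_left,
      inner_pole]
    rw [real_inner_comm (frame x (basisVec i))]
    field_simp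
    ring
  rw [Finset.sum_sub_distrib, ← Finset.mul_sum,
    Finset.sum_add_distrib, ← Finset.mul_sum, ← Finset.mul_sum, hb, he]
  simp only [inner_pole_left, pole_last, inner_pole, Finset.sum_const, Finset.card_univ,
    Fintype.card_fin, nsmul_eq_mul]
  field_simp
  linear_combination (2 * speed t * (x : Euc (m + 1)) (Fin.last m)) * hp'

theorem integrand_phi {m : ℕ} {t : ℝ} (ht : 0 < t) (x : Sphere m) :
    (roundMetric m).inner (phi m t x) (tension (m := m) (n := m) (roundMetric m) (roundMetric m) (phi m t) x)
      (tension (m := m) (n := m) (roundMetric m) (roundMetric m) (phi m t) x)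
      + (2 / 3) * scal (roundMetric m) x *
        normSqDifferential (m := m) (n := m) (roundMetric m) (roundMetric m) (phi m t) x
      - 2 * traceRicci (m := m) (n := m) (roundMetric m) (roundMetric m) (phi m t) x =
    (1 - speed t ^ 2) * (((m : ℝ) - 2) ^ 2 * speed t ^ 2 *
        (1 - (x : Euc (m + 1)) (Fin.last m) ^ 2) /
          (1 + speed t * (x : Euc (m + 1)) (Fin.last m)) ^ 4 +
      2 / 3 * m * (m - 1) * (m - 3) / (1 + speed t * (x : Euc (m + 1)) (Fin.last m)) ^ 2) := by
  have hd := (one_add_mul_last_pos (abs_speed_lt_one ht) x).ne'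
  rw [norm_sq_tension_roundMetric, normSqDifferential_roundMetric, traceRicci_roundMetric,
    scal_roundMetric]
  simp only [pullbackCoeff_phi ht, sum_partialD_localMap_phi ht, Finset.sum_const,
    Finset.card_univ, Fintype.card_fin, nsmul_eq_mul]
  have hs := sum_inner_frame (phi m t x) (pole m) (pole m)
  have h5 : (phi m t x : Euc (m + 1)) (Fin.last m) =
      ((x : Euc (m + 1)) (Fin.last m) + speed t) / (1 + speed t * (x : Euc (m + 1)) (Fin.last m)) := by
    rw [coe_phi ht]
    simp [pole, basisVec]
    field_simp
    ring
  have hw := contraction_sq t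
  simp only [inner_pole, inner_pole_left, pole_last, h5, ← pow_two] at hs
  simp only [mul_div_assoc, mul_pow, div_pow, ← Finset.mul_sum, ← Finset.sum_div, hs, hw]
  field_simp
  ring

/-! ### Integration over the sphere -/

instance isFiniteMeasure_sphereVolume (m : ℕ) : IsFiniteMeasure (sphereVolume m) := by
  unfold sphereVolume; infer_instance

theorem sphereVolume_real_univ_pos (m : ℕ) : 0 < (sphereVolume m).real Set.univ := by
  have h : sphereVolume m ≠ 0 := Measure.toSphere_ne_zero _
  rw [measureReal_def]
  exact ENNReal.toReal_pos (by simpa using h) (measure_ne_top _ _)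

/-- The map of the sphere induced by a linear isometry. -/
def sphereMap {m : ℕ} (R : Euc (m + 1) ≃ₗᵢ[ℝ] Euc (m + 1)) (x : Sphere m) : Sphere m :=
  ⟨R x, by simp⟩

theorem continuous_sphereMap {m : ℕ} (R : Euc (m + 1) ≃ₗᵢ[ℝ] Euc (m + 1)) :
    Continuous (sphereMap R) :=
  Continuous.subtype_mk (R.continuous.comp continuous_subtype_val) _

/-- Surface measure is defined through volumes of cones over subsets of the sphere, and a linear
isometry carries cones to cones and preserves volume. -/
theorem measurePreserving_sphereMap {m : ℕ} (R : Euc (m + 1) ≃ₗᵢ[ℝ] Euc (m + 1)) :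
    MeasurePreserving (sphereMap R) (sphereVolume m) (sphereVolume m) := by
  refine ⟨(continuous_sphereMap R).measurable, ?_⟩
  ext s hs
  rw [Measure.map_apply (continuous_sphereMap R).measurable hs, sphereVolume,
    Measure.toSphere_apply' _ hs,
    Measure.toSphere_apply' _ ((continuous_sphereMap R).measurable hs)]
  congr 1
  refine (congrArg _ ?_).trans
    (R.measurePreserving.measure_preimage_emb R.toHomeomorph.measurableEmbedding _)
  ext v
  simp only [Set.mem_smul, Set.mem_preimage, Set.mem_image]
  constructor
  · rintro ⟨r, hr, _, ⟨x, hx, rfl⟩, rfl⟩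
    exact ⟨r, hr, R x, ⟨sphereMap R x, hx, rfl⟩, (map_smul R r _).symm⟩
  · rintro ⟨r, hr, _, ⟨x, hx, rfl⟩, h⟩
    refine ⟨r, hr, R.symm x, ⟨sphereMap R.symm x, ?_, rfl⟩, R.injective (by simpa using h)⟩
    have : sphereMap R (sphereMap R.symm x) = x := Subtype.ext (R.apply_symm_apply _)
    rwa [this]

theorem integral_comp_sphereMap {m : ℕ} (R : Euc (m + 1) ≃ₗᵢ[ℝ] Euc (m + 1)) (f : Sphere m → ℝ) :
    ∫ x, f (sphereMap R x) ∂(sphereVolume m) = ∫ x, f x ∂(sphereVolume m) := by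
  let h : Sphere m ≃ₜ Sphere m :=
    { toFun := sphereMap R
      invFun := sphereMap R.symm
      left_inv := fun x => Subtype.ext (R.symm_apply_apply _)
      right_inv := fun x => Subtype.ext (R.apply_symm_apply _)
      continuous_toFun := continuous_sphereMap R
      continuous_invFun := continuous_sphereMap R.symm }
  exact (measurePreserving_sphereMap R).integral_comp h.measurableEmbedding f

/-- The last coordinate `cos r`. -/
def height {m : ℕ} (x : Sphere m) : ℝ := (x : Euc (m + 1)) (Fin.last m)

theorem continuous_coord {m : ℕ} (i : Fin (m + 1)) :
    Continuous (fun x : Sphere m => (x : Euc (m + 1)) i) :=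
  (EuclideanSpace.proj i : Euc (m + 1) →L[ℝ] ℝ).continuous.comp continuous_subtype_val

theorem continuous_height {m : ℕ} : Continuous (height (m := m)) := continuous_coord _

theorem height_mem {m : ℕ} (x : Sphere m) : height x ∈ Set.Icc (-1 : ℝ) 1 :=
  abs_le.1 (abs_coord_le_one x _)

theorem integrable_of_continuous {m : ℕ} {f : Sphere m → ℝ} (hf : Continuous f) :
    Integrable f (sphereVolume m) :=
  hf.integrable_of_hasCompactSupport (HasCompactSupport.of_compactSpace f)

theorem continuous_comp_height {m : ℕ} {k : ℝ → ℝ} (hk : ContinuousOn k (Set.Icc (-1) 1)) :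
    Continuous (fun x : Sphere m => k (height x)) :=
  hk.comp_continuous continuous_height height_mem

/-- Only the action on two coordinates matters, so a reflection serves: the line spanned by n has
angle φ/2, and reflecting in it doubles the angle. -/
theorem exists_rotation {m : ℕ} (i : Fin m) (φ : ℝ) :
    ∃ R : Euc (m + 1) ≃ₗᵢ[ℝ] Euc (m + 1), ∀ x : Euc (m + 1),
      R x (Fin.last m) = Real.cos φ * x (Fin.last m) + Real.sin φ * x i.castSucc ∧
      R x i.castSucc = Real.sin φ * x (Fin.last m) - Real.cos φ * x i.castSucc := by
  have hne : i.castSucc ≠ Fin.last m := (Fin.castSucc_lt_last i).ne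
  set n : Euc (m + 1) := Real.cos (φ / 2) • basisVec (Fin.last m) +
    Real.sin (φ / 2) • basisVec i.castSucc with hn
  have hinner : ∀ x, inner ℝ n x =
      Real.cos (φ / 2) * x (Fin.last m) + Real.sin (φ / 2) * x i.castSucc := by
    intro x
    rw [hn, inner_add_left, inner_smul_left, inner_smul_left, real_inner_comm,
      inner_basisVec_right, real_inner_comm, inner_basisVec_right]
    simp
  have hn1 : n (Fin.last m) = Real.cos (φ / 2) := by simp [hn, basisVec, hne.symm]
  have hn2 : n i.castSucc = Real.sin (φ / 2) := by simp [hn, basisVec, hne]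
  have hnorm : ‖n‖ ^ 2 = 1 := by
    rw [← real_inner_self_eq_norm_sq, hinner, hn1, hn2]
    linarith [Real.sin_sq_add_cos_sq (φ / 2)]
  have hc : Real.cos φ = 2 * Real.cos (φ / 2) ^ 2 - 1 := by
    rw [← Real.cos_two_mul]; ring_nf
  have hs : Real.sin φ = 2 * Real.sin (φ / 2) * Real.cos (φ / 2) := by
    rw [← Real.sin_two_mul]; ring_nf
  have hsc := Real.sin_sq_add_cos_sq (φ / 2)
  refine ⟨(Submodule.span ℝ {n}).reflection, fun x => ?_⟩
  rw [Submodule.reflection_singleton_apply]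
  simp only [PiLp.sub_apply, PiLp.smul_apply, nsmul_eq_mul, smul_eq_mul, hn1, hn2, hinner]
  simp only [RCLike.ofReal_real_eq_id, id_eq, hnorm, div_one, Nat.cast_ofNat]
  constructor
  · rw [hc, hs]; ring
  · rw [hc, hs]; linear_combination (2 * x i.castSucc) * hsc

/-- The integral of x_i k(s) is unchanged when composed with the isometries of `exists_rotation`.
Its derivative in the angle at 0 is the difference of the two sides. -/
theorem integral_height_mul_eq_integral_coord_sq_mul {m : ℕ} {k k' : ℝ → ℝ} (i : Fin m)
    (hk : ∀ s ∈ Set.Icc (-1 : ℝ) 1, HasDerivAt k (k' s) s)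
    (hk' : ContinuousOn k' (Set.Icc (-1) 1)) :
    ∫ x : Sphere m, height x * k (height x) ∂(sphereVolume m) =
      ∫ x : Sphere m, (x : Euc (m + 1)) i.castSucc ^ 2 * k' (height x) ∂(sphereVolume m) := by
  have hkc : ContinuousOn k (Set.Icc (-1) 1) := fun s hs => (hk s hs).continuousAt.continuousWithinAt
  obtain ⟨A, hA⟩ := isCompact_Icc.exists_bound_of_continuousOn hkc
  obtain ⟨B, hB⟩ := isCompact_Icc.exists_bound_of_continuousOn hk'
  choose R hR using exists_rotation (m := m) i
  have hRl : ∀ φ (x : Sphere m), height (sphereMap (R φ) x) =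
      Real.cos φ * height x + Real.sin φ * (x : Euc (m + 1)) i.castSucc := fun φ x => (hR φ x).1
  have hRi : ∀ φ (x : Sphere m), (sphereMap (R φ) x : Euc (m + 1)) i.castSucc =
      Real.sin φ * height x - Real.cos φ * (x : Euc (m + 1)) i.castSucc := fun φ x => (hR φ x).2
  have hmem : ∀ φ (x : Sphere m),
      Real.cos φ * height x + Real.sin φ * (x : Euc (m + 1)) i.castSucc ∈ Set.Icc (-1 : ℝ) 1 :=
    fun φ x => hRl φ x ▸ height_mem _
  have habs : ∀ φ (x : Sphere m),
      |Real.sin φ * height x - Real.cos φ * (x : Euc (m + 1)) i.castSucc| ≤ 1 :=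
    fun φ x => hRi φ x ▸ abs_coord_le_one _ _
  set F : ℝ → Sphere m → ℝ := fun φ x =>
    (Real.sin φ * height x - Real.cos φ * (x : Euc (m + 1)) i.castSucc) *
      k (Real.cos φ * height x + Real.sin φ * (x : Euc (m + 1)) i.castSucc) with hF
  set F' : ℝ → Sphere m → ℝ := fun φ x =>
    (Real.cos φ * height x + Real.sin φ * (x : Euc (m + 1)) i.castSucc) *
      k (Real.cos φ * height x + Real.sin φ * (x : Euc (m + 1)) i.castSucc) -
    (Real.sin φ * height x - Real.cos φ * (x : Euc (m + 1)) i.castSucc) ^ 2 *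
      k' (Real.cos φ * height x + Real.sin φ * (x : Euc (m + 1)) i.castSucc) with hF'
  have hlin : ∀ φ : ℝ, Continuous fun x : Sphere m =>
      Real.cos φ * height x + Real.sin φ * (x : Euc (m + 1)) i.castSucc := fun φ =>
    (continuous_const.mul continuous_height).add (continuous_const.mul (continuous_coord _))
  have hlin' : ∀ φ : ℝ, Continuous fun x : Sphere m =>
      Real.sin φ * height x - Real.cos φ * (x : Euc (m + 1)) i.castSucc := fun φ =>
    (continuous_const.mul continuous_height).sub (continuous_const.mul (continuous_coord _))
  have hFc : ∀ φ, Continuous (F φ) := fun φ =>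
    (hlin' φ).mul (hkc.comp_continuous (hlin φ) (hmem φ))
  have hFc' : ∀ φ, Continuous (F' φ) := fun φ =>
    ((hlin φ).mul (hkc.comp_continuous (hlin φ) (hmem φ))).sub
      (((hlin' φ).pow 2).mul (hk'.comp_continuous (hlin φ) (hmem φ)))
  -- The images stay on the sphere, so all coordinates lie in [-1, 1] and A + B dominates the
  -- derivative for every angle.
  have hderiv := hasDerivAt_integral_of_dominated_loc_of_deriv_le (μ := sphereVolume m)
    (F := F) (F' := F') (x₀ := 0) (s := Set.univ) (bound := fun _ => A + B) univ_mem
    (Eventually.of_forall fun φ => (hFc φ).aestronglyMeasurable)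
    (integrable_of_continuous (hFc 0)) (hFc' 0).aestronglyMeasurable
    (Eventually.of_forall fun x φ _ => by
      have h1 := hA _ (hmem φ x)
      have h2 := hB _ (hmem φ x)
      have h3 := abs_le.2 (hmem φ x)
      have h4 := habs φ x
      have h5 : |Real.sin φ * height x - Real.cos φ * (x : Euc (m + 1)) i.castSucc| ^ 2 ≤ 1 :=
        pow_le_one₀ (abs_nonneg _) h4
      rw [Real.norm_eq_abs] at h1 h2 ⊢
      refine (abs_sub _ _).trans ?_
      rw [abs_mul, abs_mul, abs_pow]
      refine add_le_add ?_ ?_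
      · exact (mul_le_of_le_one_left (abs_nonneg _) h3).trans h1
      · exact (mul_le_of_le_one_left (abs_nonneg _) h5).trans h2)
    (integrable_const _)
    (Eventually.of_forall fun x φ _ => by
      have h1 : HasDerivAt (fun φ => Real.sin φ * height x -
          Real.cos φ * (x : Euc (m + 1)) i.castSucc) _ φ :=
        ((Real.hasDerivAt_sin φ).mul_const _).sub ((Real.hasDerivAt_cos φ).mul_const _)
      have h2 : HasDerivAt (fun φ => Real.cos φ * height x +
          Real.sin φ * (x : Euc (m + 1)) i.castSucc) _ φ :=
        ((Real.hasDerivAt_cos φ).mul_const _).add ((Real.hasDerivAt_sin φ).mul_const _)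
      have h3 := (hk _ (hmem φ x)).comp φ h2
      refine (h1.mul h3).congr_deriv ?_
      simp only [hF', Function.comp_apply]
      ring)
  have hconst : ∀ φ, ∫ x, F φ x ∂(sphereVolume m) =
      ∫ x : Sphere m, (x : Euc (m + 1)) i.castSucc * k (height x) ∂(sphereVolume m) := by
    intro φ
    rw [← integral_comp_sphereMap (R φ)
      (fun x : Sphere m => (x : Euc (m + 1)) i.castSucc * k (height x))]
    simp only [hRl, hRi, hF]
  have h0 : ∫ x, F' 0 x ∂(sphereVolume m) = 0 := by
    refine hderiv.2.unique ?_
    simp only [hconst]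
    exact hasDerivAt_const _ _
  simp only [hF', Real.cos_zero, Real.sin_zero, one_mul, zero_mul, add_zero, zero_sub, neg_sq] at h0
  rw [integral_sub] at h0
  · linarith
  · exact integrable_of_continuous (continuous_height.mul (continuous_comp_height hkc))
  · exact integrable_of_continuous (((continuous_coord _).pow 2).mul (continuous_comp_height hk'))

theorem sum_coord_sq {m : ℕ} (x : Sphere m) :
    ∑ i : Fin m, (x : Euc (m + 1)) i.castSucc ^ 2 = 1 - height x ^ 2 := by
  have h := norm_sq_horizontal (x : Euc (m + 1))
  rw [EuclideanSpace.real_norm_sq_eq] at h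
  simpa [horizontal, height] using h

/-- The divergence theorem on the sphere for gradients of functions of the height. -/
theorem integral_divergence_height {m : ℕ} {k k' : ℝ → ℝ}
    (hk : ∀ s ∈ Set.Icc (-1 : ℝ) 1, HasDerivAt k (k' s) s)
    (hk' : ContinuousOn k' (Set.Icc (-1) 1)) :
    ∫ x : Sphere m, ((1 - height x ^ 2) * k' (height x) - m * (height x * k (height x)))
      ∂(sphereVolume m) = 0 := by
  have hkc : ContinuousOn k (Set.Icc (-1) 1) := fun s hs => (hk s hs).continuousAt.continuousWithinAt
  rw [integral_sub, integral_const_mul]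
  · simp only [← sum_coord_sq, Finset.sum_mul]
    rw [integral_finsetSum]
    · simp [← integral_height_mul_eq_integral_coord_sq_mul _ hk hk']
    · exact fun i _ => integrable_of_continuous
        (((continuous_coord _).pow 2).mul (continuous_comp_height hk'))
  · exact integrable_of_continuous ((continuous_const.sub (continuous_height.pow 2)).mul
      (continuous_comp_height hk'))
  · exact integrable_of_continuous (continuous_const.mul
      (continuous_height.mul (continuous_comp_height hkc)))

theorem integral_height {m : ℕ} (hm : 0 < m) :
    ∫ x : Sphere m, height x ∂(sphereVolume m) = 0 := by
  have h := integral_divergence_height (m := m) (k := fun _ => 1) (k' := fun _ => 0)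
    (fun s _ => hasDerivAt_const s 1) continuousOn_const
  simp only [mul_zero, mul_one, zero_sub, integral_neg, integral_const_mul, neg_eq_zero,
    mul_eq_zero] at h
  exact h.resolve_left (by positivity)

theorem integral_height_sq (m : ℕ) :
    ((m : ℝ) + 1) * ∫ x : Sphere m, height x ^ 2 ∂(sphereVolume m) =
      (sphereVolume m).real Set.univ := by
  have h := integral_divergence_height (m := m) (k := fun s => s) (k' := fun _ => 1)
    (fun s _ => hasDerivAt_id s) continuousOn_const
  have hi : Integrable (fun x : Sphere m => height x ^ 2) (sphereVolume m) :=
    integrable_of_continuous (continuous_height.pow 2)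
  have he : ∀ x : Sphere m, (1 - height x ^ 2) * 1 - m * (height x * height x) =
      1 - ((m : ℝ) + 1) * height x ^ 2 := fun x => by ring
  simp only [he] at h
  rw [integral_sub (integrable_const _) (hi.const_mul _), integral_const_mul] at h
  simp at h
  linarith

/-! ### The conformal bienergy of `φ_t` -/

/-- The energy density of `φ_t` at height `s`, where `u = (1 - t²) / (1 + t²)`. -/
def density (m : ℕ) (u s : ℝ) : ℝ :=
  (1 - u ^ 2) * (((m : ℝ) - 2) ^ 2 * u ^ 2 * (1 - s ^ 2) / (1 + u * s) ^ 4 +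
    2 / 3 * m * (m - 1) * (m - 3) / (1 + u * s) ^ 2)

theorem hc_eq {m : ℕ} {t : ℝ} (ht : 0 < t) :
    hc m t = 1 / 2 * ∫ x, density m (speed t) (height x) ∂(sphereVolume m) := by
  rw [hc, conformalBienergy]
  congr 1
  exact integral_congr_ae (Eventually.of_forall fun x => integrand_phi ht x)

theorem continuous_density {m : ℕ} {u : ℝ} (hu : |u| < 1) :
    Continuous (fun x : Sphere m => density m u (height x)) := by
  refine continuous_comp_height (k := density m u) fun s hs => ContinuousAt.continuousWithinAt ?_
  have h := (one_add_mul_pos hu hs).ne'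
  unfold density
  fun_prop (disch := positivity)

theorem density_coeff_pos {m : ℕ} (hm : 4 ≤ m) : (0 : ℝ) < 2 / 3 * m * (m - 1) * (m - 3) := by
  have h : (4 : ℝ) ≤ m := by exact_mod_cast hm
  have h1 : (0 : ℝ) < m - 1 := by linarith
  have h2 : (0 : ℝ) < m - 3 := by linarith
  positivity

theorem density_pos {m : ℕ} (hm : 4 ≤ m) {u s : ℝ} (hu : |u| < 1) (hs : s ∈ Set.Icc (-1 : ℝ) 1) :
    0 < density m u s := by
  have h := one_add_mul_pos hu hs
  have hB := density_coeff_pos hm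
  have h1 : 0 < 1 - u ^ 2 := by
    have := (sq_lt_one_iff_abs_lt_one u).2 hu
    linarith
  have h2 : 0 ≤ 1 - s ^ 2 := by nlinarith [hs.1, hs.2]
  unfold density
  positivity

theorem hc_pos {m : ℕ} (hm : 4 ≤ m) {t : ℝ} (ht : 0 < t) : 0 < hc m t := by
  have hu := abs_speed_lt_one ht
  rw [hc_eq ht]
  refine mul_pos (by norm_num) ?_
  rw [integral_pos_iff_support_of_nonneg (fun x => (density_pos hm hu (height_mem x)).le)
    (integrable_of_continuous (continuous_density hu))]
  have : Function.support (fun x : Sphere m => density m (speed t) (height x)) = Set.univ :=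
    Set.eq_univ_of_forall fun x => (density_pos hm hu (height_mem x)).ne'
  rw [this]
  exact pos_of_ne_zero fun h => (sphereVolume_real_univ_pos m).ne' (by simp [measureReal_def, h])

/-! #### Dimension four -/

/-- The density minus 8 is a divergence, and 8 is the value of the density at u = 0. -/
theorem integral_density_four {u : ℝ} (hu : |u| < 1) :
    ∫ x : Sphere 4, density 4 u (height x) ∂(sphereVolume 4) =
      8 * (sphereVolume 4).real Set.univ := by
  have hp : ∀ s ∈ Set.Icc (-1 : ℝ) 1, 1 + u * s ≠ 0 := fun s hs => (one_add_mul_pos hu hs).ne'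
  -- This `k` solves (1 - s²)k' - 4 s k = density - 8; it is a combination of the first three powers
  -- of 1/(1 + u s), hence regular on [-1, 1].
  set k : ℝ → ℝ := fun s => u * (-(4 * (1 - u ^ 2) / 3) / (1 + u * s) ^ 3 + 8 / 3 / (1 + u * s) ^ 2 +
    8 / 3 / (1 + u * s)) with hk
  set k' : ℝ → ℝ := fun s => u ^ 2 * (4 * (1 - u ^ 2) / (1 + u * s) ^ 4 - 16 / 3 / (1 + u * s) ^ 3 -
    8 / 3 / (1 + u * s) ^ 2) with hk'
  have hkd : ∀ s ∈ Set.Icc (-1 : ℝ) 1, HasDerivAt k (k' s) s := by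
    intro s hs
    have h := hp s hs
    have h1 : HasDerivAt (fun s => 1 + u * s) (u * 1) s := ((hasDerivAt_id s).const_mul u).const_add 1
    have h2 := ((((hasDerivAt_const s (-(4 * (1 - u ^ 2) / 3))).div (h1.pow 3) (pow_ne_zero 3 h)).add
      ((hasDerivAt_const s (8 / 3 : ℝ)).div (h1.pow 2) (pow_ne_zero 2 h))).add
      ((hasDerivAt_const s (8 / 3 : ℝ)).div h1 h)).const_mul u
    refine h2.congr_deriv ?_
    simp only [hk', Pi.pow_apply]
    field_simp
    ring
  have hkc : ContinuousOn k' (Set.Icc (-1) 1) := fun s hs => by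
    have h := hp s hs
    refine ContinuousAt.continuousWithinAt ?_
    simp only [hk']
    fun_prop (disch := positivity)
  have hdiv := integral_divergence_height (m := 4) hkd hkc
  have he : ∀ x : Sphere 4, (1 - height x ^ 2) * k' (height x) -
      ((4 : ℕ) : ℝ) * (height x * k (height x)) = density 4 u (height x) - 8 := by
    intro x
    have h := hp _ (height_mem x)
    have h4 : ((4 : ℕ) : ℝ) = 4 := by norm_num
    simp only [hk', hk, density, h4]
    generalize height x = s at *
    have h' : 1 + s * u ≠ 0 := by rwa [mul_comm s u]
    field_simp
    ring
  simp only [he] at hdiv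
  rw [integral_sub (integrable_of_continuous (continuous_density hu)) (integrable_const _)] at hdiv
  simp at hdiv
  linarith

/-! #### The local maximum -/

theorem inv_one_add_sq_le {y : ℝ} (hy : |y| ≤ 1 / 2) :
    1 / (1 + y) ^ 2 ≤ 1 - 2 * y + 3 * y ^ 2 + 22 * |y| ^ 3 := by
  obtain ⟨h1, h2⟩ := abs_le.1 hy
  have hp : (1 / 2 : ℝ) ≤ 1 + y := by linarith
  have hsq : (1 / 4 : ℝ) ≤ (1 + y) ^ 2 := by nlinarith
  rw [div_le_iff₀ (by linarith)]
  have hy3 : 0 ≤ |y| ^ 3 := by positivity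
  have h3 : -(|y| ^ 3) ≤ y ^ 3 := by
    rw [← abs_pow]; exact neg_abs_le _
  -- Since (1 + y)²(1 - 2y + 3y²) = 1 + 4y³ + 3y⁴, a cubic error above 4|y|³ suffices, and 22/4
  -- exceeds 4.
  have h4 : 22 * |y| ^ 3 * (1 / 4) ≤ 22 * |y| ^ 3 * (1 + y) ^ 2 :=
    mul_le_mul_of_nonneg_left hsq (by positivity)
  nlinarith [sq_nonneg (y ^ 2)]

theorem inv_one_add_pow_four_le {y : ℝ} (hy : |y| ≤ 1 / 2) :
    1 / (1 + y) ^ 4 ≤ 1 + 160 * |y| := by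
  obtain ⟨h1, h2⟩ := abs_le.1 hy
  have hp : (1 / 2 : ℝ) ≤ 1 + y := by linarith
  have h4 : (1 / 16 : ℝ) ≤ (1 + y) ^ 4 := by
    calc (1 / 16 : ℝ) = (1 / 2) ^ 4 := by norm_num
      _ ≤ (1 + y) ^ 4 := pow_le_pow_left₀ (by norm_num) hp 4
  rw [div_le_iff₀ (by linarith)]
  -- The excess of (1 + y)⁴ over 1 is at most 10|y| in absolute value, and 160/16 = 10.
  have h5 : 160 * |y| * (1 / 16) ≤ 160 * |y| * (1 + y) ^ 4 :=
    mul_le_mul_of_nonneg_left h4 (by positivity)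
  have h6 : |y * (4 + 6 * y + 4 * y ^ 2 + y ^ 3)| ≤ |y| * 10 := by
    rw [abs_mul]
    refine mul_le_mul_of_nonneg_left (abs_le.2 ⟨?_, ?_⟩) (abs_nonneg y)
    · nlinarith [sq_nonneg y, mul_nonneg (sq_nonneg y) (by linarith : 0 ≤ 1 + y)]
    · nlinarith [mul_nonneg (by linarith : 0 ≤ 1 / 2 - y) (by linarith : 0 ≤ 1 / 2 + y),
        mul_nonneg (sq_nonneg y) (by linarith : 0 ≤ 1 / 2 - y)]
  have h7 := (abs_le.1 h6).1
  nlinarith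

theorem density_le_taylor {m : ℕ} (hm : 4 ≤ m) {u s : ℝ} (hu : |u| ≤ 1 / 2)
    (hs : s ∈ Set.Icc (-1 : ℝ) 1) :
    density m u s ≤ 2 / 3 * m * (m - 1) * (m - 3) * (1 - u ^ 2 - 2 * u * s + 3 * u ^ 2 * s ^ 2) +
      ((m : ℝ) - 2) ^ 2 * u ^ 2 * (1 - s ^ 2) +
      (160 * ((m : ℝ) - 2) ^ 2 + 24 * (2 / 3 * m * (m - 1) * (m - 3))) * |u| ^ 3 := by
  have hB := density_coeff_pos hm
  set B : ℝ := 2 / 3 * m * (m - 1) * (m - 3)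
  set a : ℝ := ((m : ℝ) - 2) ^ 2 with ha
  have ha0 : 0 ≤ a := sq_nonneg _
  have hs1 := abs_le.2 hs
  have hy1 : |u * s| ≤ |u| := by
    rw [abs_mul]; exact mul_le_of_le_one_right (abs_nonneg u) hs1
  have hy : |u * s| ≤ 1 / 2 := hy1.trans hu
  have h2 := inv_one_add_sq_le hy
  have h4 := inv_one_add_pow_four_le hy
  have hu3 : |u * s| ^ 3 ≤ |u| ^ 3 := pow_le_pow_left₀ (abs_nonneg _) hy1 3
  have hU : u ^ 2 ≤ 1 / 4 := by
    rw [← sq_abs]; nlinarith [abs_nonneg u]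
  have hS : 0 ≤ 1 - s ^ 2 := by nlinarith [hs.1, hs.2]
  have hu3' : |u| ^ 3 = u ^ 2 * |u| := by rw [← sq_abs u]; ring
  have e1 : (1 - u ^ 2) * (a * u ^ 2 * (1 - s ^ 2) / (1 + u * s) ^ 4) ≤
      a * u ^ 2 * (1 - s ^ 2) + 160 * a * |u| ^ 3 := by
    have hX : 0 ≤ a * u ^ 2 * (1 - s ^ 2) := by positivity
    calc (1 - u ^ 2) * (a * u ^ 2 * (1 - s ^ 2) / (1 + u * s) ^ 4)
        ≤ 1 * (a * u ^ 2 * (1 - s ^ 2) / (1 + u * s) ^ 4) :=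
          mul_le_mul_of_nonneg_right (by nlinarith) (by positivity)
      _ = a * u ^ 2 * (1 - s ^ 2) * (1 / (1 + u * s) ^ 4) := by ring
      _ ≤ a * u ^ 2 * (1 - s ^ 2) * (1 + 160 * |u|) :=
          mul_le_mul_of_nonneg_left (h4.trans (by linarith)) hX
      _ ≤ a * u ^ 2 * (1 - s ^ 2) + 160 * a * |u| ^ 3 := by
          rw [hu3']
          nlinarith [mul_nonneg (mul_nonneg (mul_nonneg ha0 (sq_nonneg u)) (abs_nonneg u)) (sq_nonneg s)]
  -- The 24 is 22 from the expansion plus 2 from the product of -u² with -2us.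
  have e2 : (1 - u ^ 2) * (1 / (1 + u * s) ^ 2) ≤
      1 - u ^ 2 - 2 * u * s + 3 * u ^ 2 * s ^ 2 + 24 * |u| ^ 3 := by
    calc (1 - u ^ 2) * (1 / (1 + u * s) ^ 2)
        ≤ (1 - u ^ 2) * (1 - 2 * (u * s) + 3 * (u * s) ^ 2 + 22 * |u| ^ 3) :=
          mul_le_mul_of_nonneg_left (h2.trans (by linarith)) (by linarith)
      _ ≤ _ := by
          have h5 : u ^ 2 * (u * s) ≤ |u| ^ 3 := by
            rw [hu3']
            exact mul_le_mul_of_nonneg_left ((le_abs_self _).trans hy1) (sq_nonneg u)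
          have h6 : 0 ≤ u ^ 2 * (u * s) ^ 2 := by positivity
          have h7 : 0 ≤ u ^ 2 * |u| ^ 3 := by positivity
          nlinarith
  have e3 := mul_le_mul_of_nonneg_left e2 hB.le
  calc density m u s = (1 - u ^ 2) * (a * u ^ 2 * (1 - s ^ 2) / (1 + u * s) ^ 4) +
        B * ((1 - u ^ 2) * (1 / (1 + u * s) ^ 2)) := by
        simp only [density, a, B]; ring
    _ ≤ _ := by linarith

/-- The right-hand side is the value at u = 0. The hypothesis `hu'` says that the cubic remainder is
dominated by the negative quadratic coefficient. -/
theorem integral_density_le {m : ℕ} (hm : 5 ≤ m) {u : ℝ} (hu : |u| ≤ 1 / 2)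
    (hu' : (160 * ((m : ℝ) - 2) ^ 2 + 24 * (2 / 3 * m * (m - 1) * (m - 3))) * |u| * (m + 1) ≤
      ((m : ℝ) - 2) * (m / 3) * (2 * m - 3) * (m - 4)) :
    ∫ x : Sphere m, density m u (height x) ∂(sphereVolume m) ≤
      2 / 3 * m * (m - 1) * (m - 3) * (sphereVolume m).real Set.univ := by
  have hB := density_coeff_pos (by omega : 4 ≤ m)
  set K : ℝ := 160 * ((m : ℝ) - 2) ^ 2 + 24 * (2 / 3 * m * (m - 1) * (m - 3)) with hK
  have hV := sphereVolume_real_univ_pos m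
  have hi1 : Integrable (fun x : Sphere m => height x) (sphereVolume m) :=
    integrable_of_continuous continuous_height
  have hi2 : Integrable (fun x : Sphere m => height x ^ 2) (sphereVolume m) :=
    integrable_of_continuous (continuous_height.pow 2)
  set B : ℝ := 2 / 3 * m * (m - 1) * (m - 3) with hBdef
  set a : ℝ := ((m : ℝ) - 2) ^ 2 with ha
  have h1 : ∫ x : Sphere m, density m u (height x) ∂(sphereVolume m) ≤
      ∫ x : Sphere m, ((B * (1 - u ^ 2) + a * u ^ 2 + K * |u| ^ 3) + (-2 * B * u) * height x +
        (3 * B * u ^ 2 - a * u ^ 2) * height x ^ 2) ∂(sphereVolume m) := by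
    refine integral_mono (integrable_of_continuous (continuous_density (by linarith)))
      (((integrable_const _).add (hi1.const_mul _)).add (hi2.const_mul _)) fun x => ?_
    refine (density_le_taylor (by omega) hu (height_mem x)).trans (le_of_eq ?_)
    simp only [hK, hBdef, ha]
    ring
  refine h1.trans ?_
  have hi3 : Integrable (fun x : Sphere m => (B * (1 - u ^ 2) + a * u ^ 2 + K * |u| ^ 3) +
      (-2 * B * u) * height x) (sphereVolume m) := (integrable_const _).add (hi1.const_mul _)
  rw [integral_add hi3 (hi2.const_mul _),
    integral_add (integrable_const _) (hi1.const_mul _), integral_const_mul, integral_const_mul,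
    integral_height (by omega)]
  have h2 := integral_height_sq m
  generalize (∫ x : Sphere m, height x ^ 2 ∂(sphereVolume m)) = J at *
  rw [integral_const, smul_eq_mul]
  generalize (sphereVolume m).real Set.univ = V at *
  have hm1 : (0 : ℝ) < (m : ℝ) + 1 := by positivity
  have hJ0 : 0 < J := by
    by_contra h
    nlinarith
  -- The volume is replaced by (m + 1)J, so that J becomes a common factor of all terms.
  rw [← h2]
  have hu3 : |u| ^ 3 = u ^ 2 * |u| := by rw [← sq_abs u]; ring
  have h3 : 0 ≤ J * u ^ 2 * (((m : ℝ) - 2) * (m / 3) * (2 * m - 3) * (m - 4) - K * |u| * (m + 1)) := by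
    have := sub_nonneg.2 hu'
    positivity
  rw [hu3]
  -- This is m + 1 times the averaged coefficient of u²; the factor m - 4 makes it negative exactly
  -- from dimension five on.
  have h4 : a * (m : ℝ) + B * (3 - (m + 1)) = -(((m : ℝ) - 2) * (m / 3) * (2 * m - 3) * (m - 4)) := by
    simp only [hBdef, ha]; ring
  have h5 : ((m : ℝ) - 2) * (m / 3) * (2 * m - 3) * (m - 4) = -(a * (m : ℝ) + B * (3 - (m + 1))) := by
    linarith
  rw [h5] at h3
  nlinarith

theorem isLocalMax_hc {m : ℕ} (hm : 5 ≤ m) : IsLocalMax (hc m) 1 := by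
  have hs1 : speed 1 = 0 := by simp [speed]
  have hcont : ContinuousAt speed 1 := by
    unfold speed
    fun_prop (disch := norm_num)
  set K : ℝ := 160 * ((m : ℝ) - 2) ^ 2 + 24 * (2 / 3 * m * (m - 1) * (m - 3)) with hK
  have h5 : (5 : ℝ) ≤ m := by exact_mod_cast hm
  have hpos : 0 < ((m : ℝ) - 2) * (m / 3) * (2 * m - 3) * (m - 4) := by
    have e1 : 0 < (m : ℝ) - 2 := by linarith
    have e2 : 0 < 2 * (m : ℝ) - 3 := by linarith
    have e3 : 0 < (m : ℝ) - 4 := by linarith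
    positivity
  have ev1 : ∀ᶠ t in 𝓝 (1 : ℝ), |speed t| < 1 / 2 :=
    hcont.abs.eventually_lt continuousAt_const (by simp [hs1])
  have ev2 : ∀ᶠ t in 𝓝 (1 : ℝ), K * |speed t| * (m + 1) <
      ((m : ℝ) - 2) * (m / 3) * (2 * m - 3) * (m - 4) :=
    ((continuousAt_const.mul hcont.abs).mul continuousAt_const).eventually_lt continuousAt_const
      (by simpa [hs1] using hpos)
  filter_upwards [ev1, ev2, lt_mem_nhds (zero_lt_one' ℝ)] with t h1 h2 ht
  rw [hc_eq ht, hc_eq one_pos, hs1]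
  refine mul_le_mul_of_nonneg_left ((integral_density_le hm h1.le h2.le).trans (le_of_eq ?_))
    (by norm_num)
  simp [density]
  ring

/-! #### The limit at zero -/

/-- The divergence identity for k(s) = (1 + u s)^(-q), multiplied by -u. The difference of the two
sides is the integral of q (1 + u s)^(-q-1) ((1 - u²) + (1 + u s)²), which is nonnegative. -/
theorem rpow_integral_recursion {m : ℕ} {u q : ℝ} (hu0 : 0 < u) (hu : u < 1) (hq : 0 ≤ q) :
    ((m : ℝ) - 2 * q) * ∫ x : Sphere m, (1 + u * height x) ^ (-q) ∂(sphereVolume m) ≤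
      m * ∫ x : Sphere m, (1 + u * height x) ^ (1 - q) ∂(sphereVolume m) := by
  have hp : ∀ s ∈ Set.Icc (-1 : ℝ) 1, 0 < 1 + u * s := fun s hs =>
    one_add_mul_pos (by rwa [abs_of_pos hu0]) hs
  have hcont : ∀ r : ℝ, ContinuousOn (fun s => (1 + u * s) ^ r) (Set.Icc (-1) 1) := fun r =>
    ContinuousOn.rpow_const (by fun_prop) fun s hs => Or.inl (hp s hs).ne'
  have hi : ∀ r : ℝ, Integrable (fun x : Sphere m => (1 + u * height x) ^ r) (sphereVolume m) :=
    fun r => integrable_of_continuous (continuous_comp_height (hcont r))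
  have hkd : ∀ s ∈ Set.Icc (-1 : ℝ) 1, HasDerivAt (fun s => (1 + u * s) ^ (-q))
      (-q * u * (1 + u * s) ^ (-q - 1)) s := by
    intro s hs
    have h1 : HasDerivAt (fun s => 1 + u * s) (u * 1) s := ((hasDerivAt_id s).const_mul u).const_add 1
    refine (h1.rpow_const (Or.inl (hp s hs).ne')).congr_deriv ?_
    ring
  have hdiv := integral_divergence_height (m := m) hkd (continuousOn_const.mul (hcont _))
  rw [← integral_const_mul, ← integral_const_mul, ← sub_nonneg,
    ← integral_sub ((hi _).const_mul _) ((hi _).const_mul _),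
    ← mul_zero (-u), ← hdiv, ← integral_const_mul, ← sub_nonneg, ← integral_sub]
  · refine integral_nonneg fun x => ?_
    have h := hp _ (height_mem x)
    have e1 : (1 + u * height x) ^ (1 - q) = (1 + u * height x) ^ (-q - 1) * (1 + u * height x) ^ 2 := by
      rw [← Real.rpow_natCast, ← Real.rpow_add h]; norm_num; ring_nf
    have e2 : (1 + u * height x) ^ (-q) = (1 + u * height x) ^ (-q - 1) * (1 + u * height x) := by
      nth_rewrite 3 [← Real.rpow_one (1 + u * height x)]
      rw [← Real.rpow_add h]; norm_num
    have e3 : 0 ≤ (1 + u * height x) ^ (-q - 1) := (Real.rpow_pos_of_pos h _).le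
    simp only [Pi.zero_apply]
    rw [e1, e2]
    generalize (1 + u * height x) ^ (-q - 1) = X at *
    have e4 : 0 ≤ X * q * ((1 - u ^ 2) + (1 + u * height x) ^ 2) := by
      have : 0 ≤ 1 - u ^ 2 := by nlinarith
      positivity
    refine e4.trans (le_of_eq ?_)
    ring
  · exact ((hi _).const_mul _).sub ((hi _).const_mul _)
  · refine (integrable_of_continuous ?_).const_mul _
    exact ((continuous_const.sub (continuous_height.pow 2)).mul (continuous_comp_height
      (continuousOn_const.mul (hcont _)))).sub (continuous_const.mul (continuous_height.mul
        (continuous_comp_height (hcont _))))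

/-- Three uses of the recursion raise the exponent from -9/4 to 3/4, where 1 + u s ≤ 2 gives a
bound. The factors m - 1/2 and m - 5/2 are at least 1 and m - 9/2 is at least 1/2, whence 2 · m³ · 2
and a bound uniform in u. -/
theorem integral_rpow_le {m : ℕ} (hm : 5 ≤ m) {u : ℝ} (hu0 : 0 < u) (hu : u < 1) :
    ∫ x : Sphere m, (1 + u * height x) ^ (-(9 / 4) : ℝ) ∂(sphereVolume m) ≤
      4 * m ^ 3 * (sphereVolume m).real Set.univ := by
  have h5 : (5 : ℝ) ≤ m := by exact_mod_cast hm
  have h1 := rpow_integral_recursion (m := m) (q := 9 / 4) hu0 hu (by norm_num)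
  have h2 := rpow_integral_recursion (m := m) (q := 5 / 4) hu0 hu (by norm_num)
  have h3 := rpow_integral_recursion (m := m) (q := 1 / 4) hu0 hu (by norm_num)
  rw [show (1 : ℝ) - 9 / 4 = -(5 / 4) by norm_num] at h1
  rw [show (1 : ℝ) - 5 / 4 = -(1 / 4) by norm_num] at h2
  have hp : ∀ x : Sphere m, 0 < 1 + u * height x := fun x =>
    one_add_mul_pos (by rwa [abs_of_pos hu0]) (height_mem x)
  have hle : ∀ x : Sphere m, 1 + u * height x ≤ 2 := fun x => by nlinarith [(height_mem x).2]
  have hn : ∀ r : ℝ, 0 ≤ ∫ x : Sphere m, (1 + u * height x) ^ r ∂(sphereVolume m) := fun r =>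
    integral_nonneg fun x => (Real.rpow_pos_of_pos (hp x) _).le
  have h4 : ∫ x : Sphere m, (1 + u * height x) ^ (1 - 1 / 4 : ℝ) ∂(sphereVolume m) ≤
      2 * (sphereVolume m).real Set.univ := by
    calc _ ≤ ∫ _ : Sphere m, (2 : ℝ) ∂(sphereVolume m) := by
          refine integral_mono (integrable_of_continuous ?_) (integrable_const _) fun x => ?_
          · exact (continuous_const.add (continuous_const.mul continuous_height)).rpow_const
              fun x => Or.inl (hp x).ne'
          · calc (1 + u * height x) ^ (1 - 1 / 4 : ℝ) ≤ 2 ^ (1 - 1 / 4 : ℝ) :=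
                  Real.rpow_le_rpow (hp x).le (hle x) (by norm_num)
              _ ≤ 2 ^ (1 : ℝ) := Real.rpow_le_rpow_of_exponent_le (by norm_num) (by norm_num)
              _ = 2 := Real.rpow_one 2
      _ = _ := by rw [integral_const, smul_eq_mul, mul_comm]
  have n1 := hn (-(9 / 4))
  have n2 := hn (-(5 / 4))
  have n3 := hn (-(1 / 4))
  generalize ∫ x : Sphere m, (1 + u * height x) ^ (-(9 / 4) : ℝ) ∂(sphereVolume m) = J1 at *
  generalize ∫ x : Sphere m, (1 + u * height x) ^ (-(5 / 4) : ℝ) ∂(sphereVolume m) = J2 at *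
  generalize ∫ x : Sphere m, (1 + u * height x) ^ (-(1 / 4) : ℝ) ∂(sphereVolume m) = J3 at *
  generalize ∫ x : Sphere m, (1 + u * height x) ^ (1 - 1 / 4 : ℝ) ∂(sphereVolume m) = J4 at *
  generalize (sphereVolume m).real Set.univ = V at *
  generalize (m : ℝ) = M at *
  have k3 : J3 ≤ M * (2 * V) := by nlinarith
  have k2 : J2 ≤ M * (M * (2 * V)) := by nlinarith
  have k1 : J1 ≤ 2 * (M * (M * (M * (2 * V)))) := by nlinarith
  linarith

/-- The density is of order w²/(1 + u s)³, too singular to integrate uniformly when m is 5 or 6. As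
w² ≤ 2(1 + u s), a factor w^(3/2) is traded for (1 + u s)^(3/4). The exponent 9/4 is below 5/2, so
the power is integrable uniformly in u for m ≥ 5, and above 2, so a positive power of w survives. -/
theorem density_le_rpow {m : ℕ} (hm : 4 ≤ m) {u w s : ℝ} (hu0 : 0 < u) (hu : u < 1) (hw : 0 < w)
    (hwu : w ^ 2 = 1 - u ^ 2) (hs : s ∈ Set.Icc (-1 : ℝ) 1) :
    density m u s ≤ (4 * (((m : ℝ) - 2) ^ 2 + 2 / 3 * m * (m - 1) * (m - 3)) * √w) *
      (1 + u * s) ^ (-(9 / 4) : ℝ) := by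
  have hB := density_coeff_pos hm
  have hp := one_add_mul_pos (by rwa [abs_of_pos hu0]) hs
  set B : ℝ := 2 / 3 * m * (m - 1) * (m - 3)
  set a : ℝ := ((m : ℝ) - 2) ^ 2 with ha
  have ha0 : 0 ≤ a := sq_nonneg _
  have hp2 : 1 + u * s ≤ 2 := by nlinarith [hs.2]
  have hpu : 1 - u ≤ 1 + u * s := by nlinarith [hs.1]
  -- The difference of the two sides is (1 + u s)² + (1 - u²).
  have h1 : u ^ 2 * (1 - s ^ 2) ≤ 2 * (1 + u * s) := by nlinarith [sq_nonneg (1 + s), sq_nonneg s]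
  have hden : density m u s = w ^ 2 * (a * (u ^ 2 * (1 - s ^ 2)) / (1 + u * s) ^ 4 +
      B / (1 + u * s) ^ 2) := by
    rw [hwu]; simp only [density, a, B]; ring
  have h2 : density m u s ≤ w ^ 2 * (2 * (a + B) / (1 + u * s) ^ 3) := by
    rw [hden]
    refine mul_le_mul_of_nonneg_left ?_ (sq_nonneg w)
    calc a * (u ^ 2 * (1 - s ^ 2)) / (1 + u * s) ^ 4 + B / (1 + u * s) ^ 2
        ≤ a * (2 * (1 + u * s)) / (1 + u * s) ^ 4 + B * 2 / (1 + u * s) ^ 3 := by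
          refine add_le_add ?_ ?_
          · gcongr
          · rw [div_le_div_iff₀ (by positivity) (by positivity)]
            have : 0 ≤ B * (1 + u * s) ^ 2 := by positivity
            nlinarith
      _ = 2 * (a + B) / (1 + u * s) ^ 3 := by field_simp
  have h3 : w ^ 2 ≤ 2 * (1 + u * s) := by rw [hwu]; nlinarith
  have h4 : w ^ 2 ≤ √w * (2 * (1 + u * s) ^ (3 / 4 : ℝ)) := by
    have e1 : w ^ 2 = √w * (w ^ 2) ^ (3 / 4 : ℝ) := by
      rw [Real.sqrt_eq_rpow, ← Real.rpow_natCast, ← Real.rpow_mul hw.le, ← Real.rpow_add hw]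
      norm_num
    rw [e1]
    refine mul_le_mul_of_nonneg_left ?_ (Real.sqrt_nonneg w)
    calc (w ^ 2) ^ (3 / 4 : ℝ) ≤ (2 * (1 + u * s)) ^ (3 / 4 : ℝ) :=
          Real.rpow_le_rpow (sq_nonneg w) h3 (by norm_num)
      _ = 2 ^ (3 / 4 : ℝ) * (1 + u * s) ^ (3 / 4 : ℝ) := Real.mul_rpow (by norm_num) hp.le
      _ ≤ 2 * (1 + u * s) ^ (3 / 4 : ℝ) := by
          refine mul_le_mul_of_nonneg_right ?_ (Real.rpow_pos_of_pos hp _).le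
          calc (2 : ℝ) ^ (3 / 4 : ℝ) ≤ 2 ^ (1 : ℝ) :=
                Real.rpow_le_rpow_of_exponent_le (by norm_num) (by norm_num)
            _ = 2 := Real.rpow_one 2
  have h5 : (1 + u * s) ^ (-(9 / 4) : ℝ) = (1 + u * s) ^ (3 / 4 : ℝ) / (1 + u * s) ^ 3 := by
    rw [← Real.rpow_natCast, ← Real.rpow_sub hp]
    norm_num
  calc density m u s ≤ w ^ 2 * (2 * (a + B) / (1 + u * s) ^ 3) := h2
    _ ≤ √w * (2 * (1 + u * s) ^ (3 / 4 : ℝ)) * (2 * (a + B) / (1 + u * s) ^ 3) :=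
        mul_le_mul_of_nonneg_right h4 (by positivity)
    _ = _ := by rw [h5]; ring

theorem tendsto_hc_zero {m : ℕ} (hm : 5 ≤ m) : Tendsto (hc m) (𝓝[>] 0) (𝓝 0) := by
  have hm4 : 4 ≤ m := by omega
  set C : ℝ := 1 / 2 * (4 * (((m : ℝ) - 2) ^ 2 + 2 / 3 * m * (m - 1) * (m - 3)) *
    (4 * m ^ 3 * (sphereVolume m).real Set.univ)) with hC
  have hlim : Tendsto (fun t : ℝ => C * √(contraction t)) (𝓝[>] 0) (𝓝 0) := by
    have hc : ContinuousAt (fun t : ℝ => C * √(contraction t)) 0 := by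
      unfold contraction
      fun_prop (disch := norm_num)
    have h0 : C * √(contraction 0) = 0 := by simp [contraction]
    have h1 := hc.tendsto.mono_left (nhdsWithin_le_nhds (s := Set.Ioi 0))
    rwa [h0] at h1
  refine tendsto_of_tendsto_of_tendsto_of_le_of_le' tendsto_const_nhds hlim ?_ ?_
  · filter_upwards [self_mem_nhdsWithin] with t ht using (hc_pos hm4 ht).le
  -- Restricting to t < 1 makes u positive, as the integral bound requires.
  · filter_upwards [Ioo_mem_nhdsGT (zero_lt_one' ℝ)] with t ht
    have ht0 : 0 < t := ht.1
    have hu0 : 0 < speed t := by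
      have : 0 < 1 - t ^ 2 := by nlinarith [ht.1, ht.2]
      unfold speed; positivity
    have hu := (abs_lt.1 (abs_speed_lt_one ht0)).2
    have hcont : Continuous fun x : Sphere m => (1 + speed t * height x) ^ (-(9 / 4) : ℝ) :=
      (continuous_const.add (continuous_const.mul continuous_height)).rpow_const fun x =>
        Or.inl (one_add_mul_pos (abs_speed_lt_one ht0) (height_mem x)).ne'
    have h1 : ∫ x, density m (speed t) (height x) ∂(sphereVolume m) ≤
        (4 * (((m : ℝ) - 2) ^ 2 + 2 / 3 * m * (m - 1) * (m - 3)) * √(contraction t)) *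
          ∫ x : Sphere m, (1 + speed t * height x) ^ (-(9 / 4) : ℝ) ∂(sphereVolume m) := by
      rw [← integral_const_mul]
      exact integral_mono (integrable_of_continuous (continuous_density (abs_speed_lt_one ht0)))
        ((integrable_of_continuous hcont).const_mul _) fun x =>
        density_le_rpow hm4 hu0 hu (contraction_pos ht0) (contraction_sq t) (height_mem x)
    have hB := density_coeff_pos hm4
    have h2 := mul_le_mul_of_nonneg_left (integral_rpow_le hm hu0 hu)
      (by positivity : 0 ≤ 4 * (((m : ℝ) - 2) ^ 2 + 2 / 3 * m * (m - 1) * (m - 3)) * √(contraction t))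
    rw [hc_eq ht0]
    have h3 := h1.trans h2
    simp only [hC]
    linarith

end ConformalBienergy

end

theorem mainTheorem7 :
    (∀ m : ℕ, 4 ≤ m → ∀ t : ℝ, 0 < t →
      ContMDiff (𝓡 m) (𝓡 m) ∞ (ConformalBienergy.phi m t) ∧ 0 < ConformalBienergy.hc m t) ∧
    (∀ t : ℝ, 0 < t →
      ConformalBienergy.hc 4 t = 4 * (ConformalBienergy.sphereVolume 4).real Set.univ) ∧
    (∀ m : ℕ, 5 ≤ m →
      IsLocalMax (ConformalBienergy.hc m) 1 ∧
      Tendsto (ConformalBienergy.hc m) (𝓝[>] 0) (𝓝 0)) := by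
  refine ⟨fun m hm t ht => ⟨ConformalBienergy.contMDiff_phi ht, ConformalBienergy.hc_pos hm ht⟩,
    fun t ht => ?_, fun m hm => ⟨ConformalBienergy.isLocalMax_hc hm,
      ConformalBienergy.tendsto_hc_zero hm⟩⟩
  rw [ConformalBienergy.hc_eq ht,
    ConformalBienergy.integral_density_four (ConformalBienergy.abs_speed_lt_one ht)]
  ring
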